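/- Let $S^4_+=\{y\in\mathbb{R}^5: |y|=1,\ y_5\ge 0\}$ be the closed hemisphere and $g_0$ its standard round metric. For a Riemannian metric $g$ in dimension $n=4$ let $$Q_g=-\Delta_g J-2|A|_g^2+\tfrac n2 J^2,\qquad J=\frac{R_g}{2(n-1)},\qquad A=\frac{1}{n-2}\left(\mathrm{Ric}_g-Jg\right),$$ where $R_g$ is the scalar curvature, and let $Q_0$ be the (constant) $Q$ curvature of $g_0$. Let $g$ be a Riemannian metric on $S^4_+$, smooth up to the boundary, which is pointwise conformal to $g_0$. Suppose that 1. $Q_g\ge Q_0$ on $S^4_+$; 2. the metric induced by $g$ on $\partial S^4_+$ coincides with the one induced by $g_0$; 3. $\partial S^4_+$ is totally geodesic with respect to $g$; 4. $\int_{\partial S^4_+}T\,d\sigma\ge 0$, where $d\sigma$ is the volume element of the induced metric and $T$ is the Chang–Qing boundary curvature of $g$, which for a totally geodesic boundary is $T=\frac1{12}\frac{\partial R_g}{\partial\nu}$, $\nu$ being the outward unit normal of the boundary with respect to $g$. Then $g=g_0$. -/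

import Mathlib

open scoped ContDiff RealInnerProductSpace

noncomputable section

/-! # Riemannian curvature in coordinates

`D` is a domain in `ℝⁿ` (open, or closed with the boundary contained in the closure of the
interior; derivatives are taken within `D`, hence are one-sided at boundary points), and
`h : ℝⁿ → Matrix` are the components `h_{ij}` of a Riemannian metric on `D`. -/

namespace Coord

variable {n : ℕ}

/-- The `i`-th partial derivative `∂_i f` within `D`. -/
def partialDeriv (D : Set (EuclideanSpace ℝ (Fin n))) (i : Fin n)
    (f : EuclideanSpace ℝ (Fin n) → ℝ) (x : EuclideanSpace ℝ (Fin n)) : ℝ :=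
  fderivWithin ℝ f D x (EuclideanSpace.single i 1)

/-- Christoffel symbols `Γ^k_{ij} = ½ h^{kl} (∂_i h_{jl} + ∂_j h_{il} - ∂_l h_{ij})` of the
Levi-Civita connection. -/
def christoffel (D : Set (EuclideanSpace ℝ (Fin n)))
    (h : EuclideanSpace ℝ (Fin n) → Matrix (Fin n) (Fin n) ℝ) (k i j : Fin n)
    (x : EuclideanSpace ℝ (Fin n)) : ℝ :=
  (1 / 2) * ∑ l, (h x)⁻¹ k l *
    (partialDeriv D i (fun y => h y j l) x + partialDeriv D j (fun y => h y i l) x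
      - partialDeriv D l (fun y => h y i j) x)

/-- The Ricci tensor
`Ric_{ij} = ∂_k Γ^k_{ij} - ∂_j Γ^k_{ik} + Γ^k_{kl} Γ^l_{ij} - Γ^k_{jl} Γ^l_{ik}`
(positive for round spheres). -/
def ricci (D : Set (EuclideanSpace ℝ (Fin n)))
    (h : EuclideanSpace ℝ (Fin n) → Matrix (Fin n) (Fin n) ℝ) (i j : Fin n)
    (x : EuclideanSpace ℝ (Fin n)) : ℝ :=
  ∑ k, (partialDeriv D k (christoffel D h k i j) x - partialDeriv D j (christoffel D h k i k) x
    + ∑ l, (christoffel D h k k l x * christoffel D h l i j x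
      - christoffel D h k j l x * christoffel D h l i k x))

/-- The scalar curvature `R = h^{ij} Ric_{ij}`. -/
def scalarCurvature (D : Set (EuclideanSpace ℝ (Fin n)))
    (h : EuclideanSpace ℝ (Fin n) → Matrix (Fin n) (Fin n) ℝ)
    (x : EuclideanSpace ℝ (Fin n)) : ℝ :=
  ∑ i, ∑ j, (h x)⁻¹ i j * ricci D h i j x

/-- `J = R / (2 (n - 1))`. -/
def schoutenTrace (D : Set (EuclideanSpace ℝ (Fin n)))
    (h : EuclideanSpace ℝ (Fin n) → Matrix (Fin n) (Fin n) ℝ)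
    (x : EuclideanSpace ℝ (Fin n)) : ℝ :=
  scalarCurvature D h x / (2 * ((n : ℝ) - 1))

/-- The Schouten tensor `A = (Ric - J h) / (n - 2)`. -/
def schouten (D : Set (EuclideanSpace ℝ (Fin n)))
    (h : EuclideanSpace ℝ (Fin n) → Matrix (Fin n) (Fin n) ℝ) (i j : Fin n)
    (x : EuclideanSpace ℝ (Fin n)) : ℝ :=
  (ricci D h i j x - schoutenTrace D h x * h x i j) / ((n : ℝ) - 2)

/-- `|A|² = h^{ik} h^{jl} A_{ij} A_{kl}`. -/
def schoutenNormSq (D : Set (EuclideanSpace ℝ (Fin n)))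
    (h : EuclideanSpace ℝ (Fin n) → Matrix (Fin n) (Fin n) ℝ)
    (x : EuclideanSpace ℝ (Fin n)) : ℝ :=
  ∑ i, ∑ j, ∑ k, ∑ l,
    (h x)⁻¹ i k * (h x)⁻¹ j l * schouten D h i j x * schouten D h k l x

/-- The Laplace-Beltrami operator `Δ f = h^{ij} (∂_i ∂_j f - Γ^k_{ij} ∂_k f)`. -/
def laplaceBeltrami (D : Set (EuclideanSpace ℝ (Fin n)))
    (h : EuclideanSpace ℝ (Fin n) → Matrix (Fin n) (Fin n) ℝ)
    (f : EuclideanSpace ℝ (Fin n) → ℝ) (x : EuclideanSpace ℝ (Fin n)) : ℝ :=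
  ∑ i, ∑ j, (h x)⁻¹ i j *
    (partialDeriv D i (partialDeriv D j f) x
      - ∑ k, christoffel D h k i j x * partialDeriv D k f x)

/-- The `Q` curvature `Q = -Δ J - 2 |A|² + (n / 2) J²`. -/
def qCurvature (D : Set (EuclideanSpace ℝ (Fin n)))
    (h : EuclideanSpace ℝ (Fin n) → Matrix (Fin n) (Fin n) ℝ)
    (x : EuclideanSpace ℝ (Fin n)) : ℝ :=
  -laplaceBeltrami D h (schoutenTrace D h) x - 2 * schoutenNormSq D h x
    + (n : ℝ) / 2 * schoutenTrace D h x ^ 2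

/-! ## Boundary geometry of the closed unit ball

The outward conormal of the sphere through `x` centred at the origin is `∑ x_i dx^i`. -/

/-- `h^{ij} x_i x_j`, the squared `h`-length of the outward conormal `∑ x_i dx^i`. -/
def conormalSq (h : EuclideanSpace ℝ (Fin n) → Matrix (Fin n) (Fin n) ℝ)
    (x : EuclideanSpace ℝ (Fin n)) : ℝ :=
  ∑ i, ∑ j, (h x)⁻¹ i j * x i * x j

/-- Component `ν^k` of the outward `h`-unit normal `ν` of the sphere through `x` centred at the
origin: `ν^k = h^{kj} x_j / |x|_h`. -/
def outwardNormal (h : EuclideanSpace ℝ (Fin n) → Matrix (Fin n) (Fin n) ℝ) (k : Fin n)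
    (x : EuclideanSpace ℝ (Fin n)) : ℝ :=
  (∑ j, (h x)⁻¹ k j * x j) / √(conormalSq h x)

/-- The second fundamental form `L(X, Y) = h(∇_X ν, Y)` of the unit sphere at `x`, for vectors
`X`, `Y` tangent to it, in the metric `h` on the closed unit ball. -/
def secondFundamentalForm (h : EuclideanSpace ℝ (Fin n) → Matrix (Fin n) (Fin n) ℝ)
    (x X Y : EuclideanSpace ℝ (Fin n)) : ℝ :=
  ∑ k, ∑ l, h x k l * Y l *
    ∑ i, X i * (partialDeriv (Metric.closedBall 0 1) i (outwardNormal h k) x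
      + ∑ j, christoffel (Metric.closedBall 0 1) h k i j x * outwardNormal h j x)

/-- The normal derivative `∂f/∂ν = ν^k ∂_k f` at the point `x` of the unit sphere. -/
def normalDeriv (h : EuclideanSpace ℝ (Fin n) → Matrix (Fin n) (Fin n) ℝ)
    (f : EuclideanSpace ℝ (Fin n) → ℝ) (x : EuclideanSpace ℝ (Fin n)) : ℝ :=
  ∑ k, outwardNormal h k x * partialDeriv (Metric.closedBall 0 1) k f x

/-- The density of the volume element `dσ` of the metric induced by `h` on the unit sphere, with
respect to the Euclidean surface measure: `√(det h · h^{ij} x_i x_j)`. -/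
def boundaryDensity (h : EuclideanSpace ℝ (Fin n) → Matrix (Fin n) (Fin n) ℝ)
    (x : EuclideanSpace ℝ (Fin n)) : ℝ :=
  √((h x).det * conormalSq h x)

end Coord

/-! # The hemisphere `S⁴₊` and its metrics -/

/-- The closed upper hemisphere `S⁴₊` of the unit sphere in `ℝ⁵`. -/
def Hemisphere : Type :=
  {y : EuclideanSpace ℝ (Fin 5) // ‖y‖ = 1 ∧ 0 ≤ y (Fin.last 4)}

namespace Hemisphere

/-- The tangent space `T_y S⁴ = y^⊥`. -/
abbrev Tangent (y : Hemisphere) : Type := ↥((ℝ ∙ y.1)ᗮ)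

/-- Inverse stereographic projection from the south pole, `ℝ⁴ → S⁴ ⊆ ℝ⁵`,
`x ↦ (2x, 1 - |x|²) / (1 + |x|²)`. It maps the closed unit ball diffeomorphically onto the closed
hemisphere. -/
def stereoInv (x : EuclideanSpace ℝ (Fin 4)) : EuclideanSpace ℝ (Fin 5) :=
  WithLp.toLp 2 (Fin.snoc (α := fun _ => ℝ) (fun i : Fin 4 => 2 * x i / (1 + ‖x‖ ^ 2))
    ((1 - ‖x‖ ^ 2) / (1 + ‖x‖ ^ 2)))

theorem stereoInv_last (x : EuclideanSpace ℝ (Fin 4)) :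
    stereoInv x (Fin.last 4) = (1 - ‖x‖ ^ 2) / (1 + ‖x‖ ^ 2) := by
  simp only [stereoInv, Fin.snoc_last]

theorem stereoInv_castSucc (x : EuclideanSpace ℝ (Fin 4)) (i : Fin 4) :
    stereoInv x i.castSucc = 2 * x i / (1 + ‖x‖ ^ 2) := by
  simp only [stereoInv, Fin.snoc_castSucc]

theorem norm_stereoInv (x : EuclideanSpace ℝ (Fin 4)) : ‖stereoInv x‖ = 1 := by
  have h : ‖stereoInv x‖ ^ 2 = 1 := by
    have hx := EuclideanSpace.real_norm_sq_eq x
    have hp : (1 + ‖x‖ ^ 2) ≠ 0 := by positivity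
    rw [EuclideanSpace.real_norm_sq_eq, Fin.sum_univ_castSucc]
    simp only [stereoInv_last, stereoInv_castSucc, div_pow, mul_pow]
    rw [← Finset.sum_div, ← Finset.mul_sum, ← hx]
    field_simp
    ring
  nlinarith [norm_nonneg (stereoInv x)]

theorem contDiff_stereoInv : ContDiff ℝ ∞ stereoInv := by
  have hp : ∀ x : EuclideanSpace ℝ (Fin 4), (1 + ‖x‖ ^ 2) ≠ 0 := fun x => by positivity
  rw [contDiff_euclidean]
  intro i
  refine Fin.lastCases ?_ (fun i => ?_) i
  · simp only [stereoInv_last]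
    exact (contDiff_const.sub (contDiff_norm_sq ℝ)).div
      (contDiff_const.add (contDiff_norm_sq ℝ)) hp
  · simp only [stereoInv_castSucc]
    exact (contDiff_const.mul (contDiff_euclidean.1 contDiff_id i)).div
      (contDiff_const.add (contDiff_norm_sq ℝ)) hp

/-- The point of the hemisphere with stereographic coordinates `x`, `|x| ≤ 1`. -/
def point (x : EuclideanSpace ℝ (Fin 4)) (hx : x ∈ Metric.closedBall 0 1) : Hemisphere :=
  ⟨stereoInv x, norm_stereoInv x, by
    rw [mem_closedBall_zero_iff] at hx
    rw [stereoInv_last]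
    have : ‖x‖ ^ 2 ≤ 1 := by nlinarith [norm_nonneg x]
    exact div_nonneg (by linarith) (by positivity)⟩

theorem fderiv_stereoInv_mem (x v : EuclideanSpace ℝ (Fin 4)) :
    fderiv ℝ stereoInv x v ∈ (ℝ ∙ stereoInv x)ᗮ := by
  rw [Submodule.mem_orthogonal_singleton_iff_inner_right]
  have hd : HasFDerivAt stereoInv (fderiv ℝ stereoInv x) x :=
    (contDiff_stereoInv.differentiable (by simp) x).hasFDerivAt
  have h1 := hd.norm_sq
  have h2 : HasFDerivAt (fun y => ‖stereoInv y‖ ^ 2)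
      (0 : EuclideanSpace ℝ (Fin 4) →L[ℝ] ℝ) x := by
    simp only [norm_stereoInv]
    exact hasFDerivAt_const _ _
  have h3 := congrArg (fun L => L v) (h1.unique h2)
  simpa using h3

/-- The coordinate vector field `∂_i` of the stereographic chart. -/
def coordVector (x : EuclideanSpace ℝ (Fin 4)) (hx : x ∈ Metric.closedBall 0 1) (i : Fin 4) :
    Tangent (point x hx) :=
  ⟨fderiv ℝ stereoInv x (EuclideanSpace.single i 1), fderiv_stereoInv_mem x _⟩

open Classical in
/-- The components `h_{ij} = h(∂_i, ∂_j)`, in stereographic coordinates on the closed unit ball,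
of a field of bilinear forms on the hemisphere (the value `0` outside the ball is never used). -/
def components (form : (y : Hemisphere) → LinearMap.BilinForm ℝ (Tangent y))
    (x : EuclideanSpace ℝ (Fin 4)) : Matrix (Fin 4) (Fin 4) ℝ :=
  if hx : x ∈ Metric.closedBall 0 1 then
    Matrix.of fun i j => form (point x hx) (coordVector x hx i) (coordVector x hx j)
  else 0

end Hemisphere

/-- A smooth (up to the boundary) Riemannian metric on the closed hemisphere `S⁴₊`. -/
@[ext]
structure HemisphereMetric where
  /-- the inner product on each tangent space -/
  form : (y : Hemisphere) → LinearMap.BilinForm ℝ (Hemisphere.Tangent y)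
  symm : ∀ y v w, form y v w = form y w v
  pos : ∀ y v, v ≠ 0 → 0 < form y v v
  smooth : ∀ i j, ContDiffOn ℝ ∞ (fun x => Hemisphere.components form x i j)
    (Metric.closedBall 0 1)

namespace HemisphereMetric

/-- The standard round metric `g₀`, induced by the Euclidean inner product of `ℝ⁵`. -/
def round : HemisphereMetric where
  form y := innerₗ (Hemisphere.Tangent y)
  symm y v w := by simpa using real_inner_comm _ _
  pos y v hv := by
    rw [innerₗ_apply_apply]
    exact real_inner_self_pos.2 hv
  smooth i j := by
    have hd : ∀ v : EuclideanSpace ℝ (Fin 4), ContDiff ℝ ∞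
        (fun x => fderiv ℝ Hemisphere.stereoInv x v) := fun v =>
      (Hemisphere.contDiff_stereoInv.fderiv_right (m := ∞) (by simp)).clm_apply contDiff_const
    refine ((hd (EuclideanSpace.single i 1)).inner ℝ
      (hd (EuclideanSpace.single j 1))).contDiffOn.congr ?_
    intro x hx
    simp only [Hemisphere.components, hx, dite_true, Matrix.of_apply, innerₗ_apply_apply,
      Submodule.coe_inner, Hemisphere.coordVector]

variable (g : HemisphereMetric)

/-- The components of `g` in stereographic coordinates on the closed unit ball of `ℝ⁴`. -/
def components : EuclideanSpace ℝ (Fin 4) → Matrix (Fin 4) (Fin 4) ℝ :=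
  Hemisphere.components g.form

/-- `g` is (pointwise) conformal to `g'`: `g = f g'` for a positive function `f` on the
hemisphere. -/
def IsConformalTo (g' : HemisphereMetric) : Prop :=
  ∃ f : Hemisphere → ℝ, (∀ y, 0 < f y) ∧ ∀ y v w, g.form y v w = f y * g'.form y v w

/-- The metrics induced by `g` and `g'` on the boundary `∂S⁴₊ = {y₅ = 0}` coincide. -/
def SameBoundaryMetric (g' : HemisphereMetric) : Prop :=
  ∀ y : Hemisphere, y.1 (Fin.last 4) = 0 → ∀ v w : Hemisphere.Tangent y,
    v.1 (Fin.last 4) = 0 → w.1 (Fin.last 4) = 0 → g.form y v w = g'.form y v w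

/-- The `Q` curvature of `g` at the point with stereographic coordinates `x`. -/
def qCurvature (x : EuclideanSpace ℝ (Fin 4)) : ℝ :=
  Coord.qCurvature (Metric.closedBall 0 1) g.components x

/-- The scalar curvature of `g` at the point with stereographic coordinates `x`. -/
def scalarCurvature (x : EuclideanSpace ℝ (Fin 4)) : ℝ :=
  Coord.scalarCurvature (Metric.closedBall 0 1) g.components x

/-- The boundary of the hemisphere is totally geodesic for `g`: its second fundamental form
vanishes. In stereographic coordinates the boundary is the unit sphere `S³`. -/
def TotallyGeodesicBoundary : Prop :=
  ∀ x : EuclideanSpace ℝ (Fin 4), ‖x‖ = 1 → ∀ X Y : EuclideanSpace ℝ (Fin 4),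
    ⟪x, X⟫ = 0 → ⟪x, Y⟫ = 0 → Coord.secondFundamentalForm g.components x X Y = 0

/-- The Chang-Qing boundary curvature of a metric with totally geodesic boundary,
`T = (1 / 12) ∂R/∂ν` with `ν` the outward unit normal, at a boundary point. -/
def tCurvature (x : EuclideanSpace ℝ (Fin 4)) : ℝ :=
  (1 / 12) * Coord.normalDeriv g.components g.scalarCurvature x

/-- `∫_{∂S⁴₊} T dσ`, with `dσ` the volume element of the metric induced by `g` on the boundary. -/
def integralT : ℝ :=
  ∫ x : Metric.sphere (0 : EuclideanSpace ℝ (Fin 4)) 1,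
    g.tCurvature x.1 * Coord.boundaryDensity g.components x.1
    ∂(MeasureTheory.volume : MeasureTheory.Measure (EuclideanSpace ℝ (Fin 4))).toSphere

end HemisphereMetric

end

/-! # Rigidity of the hemisphere under a lower bound on the `Q` curvature

In stereographic coordinates a metric conformal to the round one is `e^{2w} δ` on the closed unit
ball of `ℝ⁴`, and its `Q` curvature is `e^{-4w} Δ² w`, with `Δ` the Euclidean Laplacian
(`IsConformallyFlat.qCurvature_eq`). Write `e^{w₀} = 2 / (1 + |x|²)` for the round factor and
`u = w - w₀`. The boundary metric gives `u = 0` on the unit sphere, total geodesy gives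
`∂_r u = 0` there (`IsConformallyFlat.euler_eq_neg_one`), and since `∂R/∂ν = 24 - 6 ∂_r Δw`
(`IsConformallyFlat.normalDeriv_scalarCurvature`), the condition on `T` says that the integral of
`∂_r Δu` over the sphere is nonpositive. The bound on `Q` becomes
`Δ² u ≥ 6 e^{4w₀} (e^{4u} - 1) = 6 e^{4w₀} (4u + F)`, where `F = e^{4u} - 1 - 4u ≥ 0` vanishes
only where `u = 0`.

Integrating over the spheres `|x| = t` turns this into a differential inequality in the single
variable `t` for the spherical mean `m` of `u`, which is linear apart from the nonnegative mean `E`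
of `F`. Two facts finish the proof. Let `M` be the spherical mean of `Δu`.

* If `M(1) > 0`, then going inwards from the boundary `m` stays nonnegative, so the flux of `Δu`
  stays nonpositive and `M` stays positive down to the centre; but `∫ t³ M dt` is the boundary flux
  of `u`, which is zero. Hence `M(1) ≤ 0` (`RadialComparison.System.M_one_nonpos`).
* The function `φ = (1 - t²) / (1 + t²)`, the height function of the sphere, vanishes on the boundary
  and solves the linearized equation `Δ² φ = 24 e^{4w₀} φ`. Green's formula gives
  `M(1) ≥ 6 ∫ t³ φ e^{4w₀} E dt ≥ 0`. Hence `E = 0` (`RadialComparison.System.E_eq_zero`), so `u = 0`.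

The passage to spherical means needs only that `Δ - ∂_r² - (3/r) ∂_r` has mean zero on spheres.
With the left multiplications by the quaternion units `i`, `j`, `k`, this operator is, up to the
factor `|x|⁻²`, the sum of the second derivatives along three circle actions (`normSq_mul_lap`),
each of which has mean zero by invariance of the surface measure (`mean_circleDeriv₂`).
-/

/-- Euclidean four-space. -/
local notation "E4" => EuclideanSpace ℝ (Fin 4)
/-- The closed unit ball of `ℝ⁴`, the domain of the stereographic chart. -/
local notation "𝔹" => Metric.closedBall (0 : EuclideanSpace ℝ (Fin 4)) 1
/-- The unit sphere of `ℝ⁴`, the boundary of the chart domain. -/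
local notation "𝕊" => Metric.sphere (0 : EuclideanSpace ℝ (Fin 4)) 1
/-- Partial derivatives within the closed unit ball, one-sided at the boundary. -/
local notation "𝐃" => Coord.partialDeriv (Metric.closedBall (0 : EuclideanSpace ℝ (Fin 4)) 1)
/-- The Euclidean surface measure of the unit sphere. -/
local notation "σ" => MeasureTheory.Measure.toSphere (MeasureTheory.volume : MeasureTheory.Measure (EuclideanSpace ℝ (Fin 4)))

/-! ### Calculus on the closed unit ball -/

namespace BallCalculus

theorem uniqueDiffOn_ball : UniqueDiffOn ℝ 𝔹 :=
  uniqueDiffOn_convex (convex_closedBall _ _)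
    ⟨0, by rw [interior_closedBall _ one_ne_zero]; exact Metric.mem_ball_self one_pos⟩

theorem contDiffOn_partial {f : E4 → ℝ} (hf : ContDiffOn ℝ ∞ f 𝔹) (i : Fin 4) :
    ContDiffOn ℝ ∞ (𝐃 i f) 𝔹 :=
  (hf.fderivWithin uniqueDiffOn_ball (m := ∞) (by simp)).clm_apply contDiffOn_const

theorem diffWithin {f : E4 → ℝ} (hf : ContDiffOn ℝ ∞ f 𝔹) {x : E4} (hx : x ∈ 𝔹) :
    DifferentiableWithinAt ℝ f 𝔹 x :=
  hf.differentiableOn (by simp) x hx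

theorem fderivWithin_apply_eq (f : E4 → ℝ) (x v : E4) :
    fderivWithin ℝ f 𝔹 x v = ∑ i, v i * 𝐃 i f x := by
  conv_lhs => rw [show v = ∑ i, v i • EuclideanSpace.single i (1 : ℝ) by
    ext j; simp [Finset.sum_apply, Pi.single_apply]]
  simp [Coord.partialDeriv]

theorem partial_congr {f g : E4 → ℝ} (h : ∀ x ∈ 𝔹, f x = g x) (i : Fin 4) {x : E4}
    (hx : x ∈ 𝔹) : 𝐃 i f x = 𝐃 i g x := by
  unfold Coord.partialDeriv
  rw [fderivWithin_congr h (h x hx)]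

theorem partial_const (c : ℝ) (i : Fin 4) (x : E4) : 𝐃 i (fun _ => c) x = 0 := by
  unfold Coord.partialDeriv
  rw [fderivWithin_const_apply]; rfl

theorem partial_add {f g : E4 → ℝ} (hf : ContDiffOn ℝ ∞ f 𝔹) (hg : ContDiffOn ℝ ∞ g 𝔹)
    (i : Fin 4) {x : E4} (hx : x ∈ 𝔹) :
    𝐃 i (fun y => f y + g y) x = 𝐃 i f x + 𝐃 i g x := by
  unfold Coord.partialDeriv
  rw [fderivWithin_fun_add (uniqueDiffOn_ball x hx) (diffWithin hf hx) (diffWithin hg hx)]; rfl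

theorem partial_sub {f g : E4 → ℝ} (hf : ContDiffOn ℝ ∞ f 𝔹) (hg : ContDiffOn ℝ ∞ g 𝔹)
    (i : Fin 4) {x : E4} (hx : x ∈ 𝔹) :
    𝐃 i (fun y => f y - g y) x = 𝐃 i f x - 𝐃 i g x := by
  unfold Coord.partialDeriv
  rw [fderivWithin_fun_sub (uniqueDiffOn_ball x hx) (diffWithin hf hx) (diffWithin hg hx)]; rfl

theorem partial_neg {f : E4 → ℝ} (i : Fin 4) {x : E4} (hx : x ∈ 𝔹) :
    𝐃 i (fun y => -f y) x = -𝐃 i f x := by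
  unfold Coord.partialDeriv
  rw [fderivWithin_fun_neg (uniqueDiffOn_ball x hx)]; rfl

theorem partial_mul {f g : E4 → ℝ} (hf : ContDiffOn ℝ ∞ f 𝔹) (hg : ContDiffOn ℝ ∞ g 𝔹)
    (i : Fin 4) {x : E4} (hx : x ∈ 𝔹) :
    𝐃 i (fun y => f y * g y) x = 𝐃 i f x * g x + f x * 𝐃 i g x := by
  unfold Coord.partialDeriv
  rw [fderivWithin_fun_mul (uniqueDiffOn_ball x hx) (diffWithin hf hx) (diffWithin hg hx)]
  simp; ring

theorem partial_const_mul {f : E4 → ℝ} (hf : ContDiffOn ℝ ∞ f 𝔹) (c : ℝ)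
    (i : Fin 4) {x : E4} (hx : x ∈ 𝔹) :
    𝐃 i (fun y => c * f y) x = c * 𝐃 i f x := by
  rw [partial_mul contDiffOn_const hf i hx, partial_const, zero_mul, zero_add]

theorem partial_sum {f : Fin 4 → E4 → ℝ} (hf : ∀ j, ContDiffOn ℝ ∞ (f j) 𝔹)
    (i : Fin 4) {x : E4} (hx : x ∈ 𝔹) :
    𝐃 i (fun y => ∑ j, f j y) x = ∑ j, 𝐃 i (f j) x := by
  unfold Coord.partialDeriv
  rw [fderivWithin_fun_sum (uniqueDiffOn_ball x hx) (fun j _ => diffWithin (hf j) hx)]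
  simp

theorem partial_exp {f : E4 → ℝ} (hf : ContDiffOn ℝ ∞ f 𝔹) (c : ℝ) (i : Fin 4) {x : E4}
    (hx : x ∈ 𝔹) :
    𝐃 i (fun y => Real.exp (c * f y)) x = c * Real.exp (c * f x) * 𝐃 i f x := by
  have h := ((diffWithin hf hx).const_mul c).hasFDerivWithinAt.exp.fderivWithin
    (uniqueDiffOn_ball x hx)
  have h2 := partial_const_mul hf c i hx
  unfold Coord.partialDeriv at h2 ⊢
  rw [h]
  simp only [smul_apply, smul_eq_mul, h2]
  ring

theorem contDiffOn_exp {f : E4 → ℝ} (hf : ContDiffOn ℝ ∞ f 𝔹) (c : ℝ) :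
    ContDiffOn ℝ ∞ (fun y => Real.exp (c * f y)) 𝔹 :=
  (contDiffOn_const.mul hf).exp

theorem contDiffOn_coord (i : Fin 4) : ContDiffOn ℝ ∞ (fun y : E4 => y i) 𝔹 :=
  (contDiff_euclidean.1 contDiff_id i).contDiffOn

theorem partial_coord (i j : Fin 4) {x : E4} (hx : x ∈ 𝔹) :
    𝐃 i (fun y => y j) x = if i = j then 1 else 0 := by
  unfold Coord.partialDeriv
  have h : HasFDerivWithinAt (fun y : E4 => y j) (EuclideanSpace.proj j : E4 →L[ℝ] ℝ) 𝔹 x :=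
    (EuclideanSpace.proj j : E4 →L[ℝ] ℝ).hasFDerivWithinAt
  rw [h.fderivWithin (uniqueDiffOn_ball x hx)]
  simp [eq_comm]

/-- Second partial derivatives commute, also at the points of the boundary sphere. -/
theorem partial_comm {f : E4 → ℝ} (hf : ContDiffOn ℝ ∞ f 𝔹) (i j : Fin 4) {x : E4}
    (hx : x ∈ 𝔹) : 𝐃 i (𝐃 j f) x = 𝐃 j (𝐃 i f) x := by
  have hs : IsSymmSndFDerivWithinAt ℝ f 𝔹 x := by
    refine (hf x hx).isSymmSndFDerivWithinAt
      (by simpa using (WithTop.coe_le_coe.2 (le_top : (2 : ℕ∞) ≤ ⊤))) uniqueDiffOn_ball ?_ hx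
    rw [interior_closedBall _ one_ne_zero, closure_ball _ one_ne_zero]
    exact hx
  have hd : DifferentiableWithinAt ℝ (fderivWithin ℝ f 𝔹) 𝔹 x :=
    (hf.fderivWithin uniqueDiffOn_ball (m := ∞) (by simp)).differentiableOn (by simp) x hx
  have key : ∀ a b : Fin 4, 𝐃 a (𝐃 b f) x =
      fderivWithin ℝ (fderivWithin ℝ f 𝔹) 𝔹 x (EuclideanSpace.single a 1)
        (EuclideanSpace.single b 1) := fun a b => by
    have := fderivWithin_clm_apply (uniqueDiffOn_ball x hx) hd
      (differentiableWithinAt_const (EuclideanSpace.single b (1 : ℝ)))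
    unfold Coord.partialDeriv
    rw [this]
    simp
  rw [key, key, hs.eq]

/-- The Euclidean Laplacian on the closed unit ball (one-sided derivatives at the boundary). -/
noncomputable def lap (f : E4 → ℝ) (x : E4) : ℝ := ∑ i, 𝐃 i (𝐃 i f) x

/-- `|∇f|²`. -/
noncomputable def gradSq (f : E4 → ℝ) (x : E4) : ℝ := ∑ i, 𝐃 i f x * 𝐃 i f x

theorem contDiffOn_lap {f : E4 → ℝ} (hf : ContDiffOn ℝ ∞ f 𝔹) : ContDiffOn ℝ ∞ (lap f) 𝔹 :=
  ContDiffOn.sum fun i _ => contDiffOn_partial (contDiffOn_partial hf i) i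

theorem contDiffOn_gradSq {f : E4 → ℝ} (hf : ContDiffOn ℝ ∞ f 𝔹) :
    ContDiffOn ℝ ∞ (gradSq f) 𝔹 :=
  ContDiffOn.sum fun i _ => (contDiffOn_partial hf i).mul (contDiffOn_partial hf i)

theorem lap_congr {f g : E4 → ℝ} (h : ∀ x ∈ 𝔹, f x = g x) {x : E4} (hx : x ∈ 𝔹) :
    lap f x = lap g x :=
  Finset.sum_congr rfl fun i _ => partial_congr (fun _ hy => partial_congr h i hy) i hx

theorem lap_add {f g : E4 → ℝ} (hf : ContDiffOn ℝ ∞ f 𝔹) (hg : ContDiffOn ℝ ∞ g 𝔹)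
    {x : E4} (hx : x ∈ 𝔹) : lap (fun y => f y + g y) x = lap f x + lap g x := by
  unfold lap
  rw [← Finset.sum_add_distrib]
  refine Finset.sum_congr rfl fun i _ => ?_
  rw [partial_congr (fun y hy => partial_add hf hg i hy) i hx,
    partial_add (contDiffOn_partial hf i) (contDiffOn_partial hg i) i hx]

theorem lap_sub {f g : E4 → ℝ} (hf : ContDiffOn ℝ ∞ f 𝔹) (hg : ContDiffOn ℝ ∞ g 𝔹)
    {x : E4} (hx : x ∈ 𝔹) : lap (fun y => f y - g y) x = lap f x - lap g x := by
  unfold lap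
  rw [← Finset.sum_sub_distrib]
  refine Finset.sum_congr rfl fun i _ => ?_
  rw [partial_congr (fun y hy => partial_sub hf hg i hy) i hx,
    partial_sub (contDiffOn_partial hf i) (contDiffOn_partial hg i) i hx]

theorem lap_const_mul {f : E4 → ℝ} (hf : ContDiffOn ℝ ∞ f 𝔹) (c : ℝ)
    {x : E4} (hx : x ∈ 𝔹) : lap (fun y => c * f y) x = c * lap f x := by
  unfold lap
  rw [Finset.mul_sum]
  refine Finset.sum_congr rfl fun i _ => ?_
  rw [partial_congr (fun y hy => partial_const_mul hf c i hy) i hx,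
    partial_const_mul (contDiffOn_partial hf i) c i hx]

end BallCalculus

/-! ### Curvature of conformally flat metrics -/

namespace ConformallyFlat

open BallCalculus

variable {h : E4 → Matrix (Fin 4) (Fin 4) ℝ} {w : E4 → ℝ}

/-- `h = e^{2w} δ` on the closed unit ball, with `w` smooth up to the boundary. -/
structure IsConformallyFlat (h : E4 → Matrix (Fin 4) (Fin 4) ℝ) (w : E4 → ℝ) : Prop where
  smooth : ContDiffOn ℝ ∞ w 𝔹
  eq : ∀ x ∈ 𝔹, h x = Real.exp (2 * w x) • (1 : Matrix (Fin 4) (Fin 4) ℝ)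

namespace IsConformallyFlat

theorem inv_eq (H : IsConformallyFlat h w) {x : E4} (hx : x ∈ 𝔹) :
    (h x)⁻¹ = Real.exp (-2 * w x) • (1 : Matrix (Fin 4) (Fin 4) ℝ) := by
  refine Matrix.inv_eq_right_inv ?_
  rw [H.eq x hx, smul_mul_smul_comm, ← Real.exp_add, mul_one]
  simp

theorem christoffel_eq (H : IsConformallyFlat h w) (k i j : Fin 4) {x : E4} (hx : x ∈ 𝔹) :
    Coord.christoffel 𝔹 h k i j x = (1 : Matrix (Fin 4) (Fin 4) ℝ) k i * 𝐃 j w x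
      + (1 : Matrix (Fin 4) (Fin 4) ℝ) k j * 𝐃 i w x
      - (1 : Matrix (Fin 4) (Fin 4) ℝ) i j * 𝐃 k w x := by
  have hd : ∀ a b c : Fin 4, 𝐃 a (fun y => h y b c) x =
      (1 : Matrix (Fin 4) (Fin 4) ℝ) b c * (2 * Real.exp (2 * w x) * 𝐃 a w x) := fun a b c => by
    rw [partial_congr (g := fun y => (1 : Matrix (Fin 4) (Fin 4) ℝ) b c * Real.exp (2 * w y))
      (fun y hy => by rw [H.eq y hy]; simp [mul_comm]) a hx,
      partial_const_mul (contDiffOn_exp H.smooth 2) _ _ hx, partial_exp H.smooth _ _ hx]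
  unfold Coord.christoffel
  simp only [hd, H.inv_eq hx]
  have he : Real.exp (-2 * w x) * Real.exp (2 * w x) = 1 := by rw [← Real.exp_add]; simp
  have hs : ∀ F : Fin 4 → ℝ, ∑ l, (Real.exp (-2 * w x) • (1 : Matrix (Fin 4) (Fin 4) ℝ)) k l * F l
      = Real.exp (-2 * w x) * F k := fun F => by
    simp [Matrix.one_apply]
  have ht : ∀ a, (1 : Matrix (Fin 4) (Fin 4) ℝ) a k = (1 : Matrix (Fin 4) (Fin 4) ℝ) k a :=
    fun a => by simp only [Matrix.one_apply, eq_comm]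
  rw [hs, ht, ht]
  linear_combination ((1 : Matrix (Fin 4) (Fin 4) ℝ) k i * 𝐃 j w x
      + (1 : Matrix (Fin 4) (Fin 4) ℝ) k j * 𝐃 i w x
      - (1 : Matrix (Fin 4) (Fin 4) ℝ) i j * 𝐃 k w x) * he

theorem partial_christoffel (H : IsConformallyFlat h w) (l k i j : Fin 4) {x : E4} (hx : x ∈ 𝔹) :
    𝐃 l (Coord.christoffel 𝔹 h k i j) x =
      (1 : Matrix (Fin 4) (Fin 4) ℝ) k i * 𝐃 l (𝐃 j w) x
      + (1 : Matrix (Fin 4) (Fin 4) ℝ) k j * 𝐃 l (𝐃 i w) x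
      - (1 : Matrix (Fin 4) (Fin 4) ℝ) i j * 𝐃 l (𝐃 k w) x := by
  have hs := fun a => contDiffOn_partial H.smooth a
  have hc := fun (c : ℝ) a => (contDiffOn_const (c := c)).mul (hs a)
  rw [partial_congr (fun y hy => H.christoffel_eq k i j hy) l hx,
    partial_sub ((hc _ _).add (hc _ _)) (hc _ _) l hx, partial_add (hc _ _) (hc _ _) l hx,
    partial_const_mul (hs _) _ l hx, partial_const_mul (hs _) _ l hx,
    partial_const_mul (hs _) _ l hx]

theorem ricci_eq (H : IsConformallyFlat h w) (i j : Fin 4) {x : E4} (hx : x ∈ 𝔹) :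
    Coord.ricci 𝔹 h i j x = -2 * (𝐃 i (𝐃 j w) x - 𝐃 i w x * 𝐃 j w x)
      - (lap w x + 2 * gradSq w x) * (1 : Matrix (Fin 4) (Fin 4) ℝ) i j := by
  unfold Coord.ricci lap gradSq
  simp only [H.partial_christoffel _ _ _ _ hx, H.christoffel_eq _ _ _ hx, Matrix.one_apply]
  have hc := fun a b => partial_comm H.smooth a b hx
  have h10 := hc 1 0
  have h20 := hc 2 0
  have h30 := hc 3 0
  have h21 := hc 2 1
  have h31 := hc 3 1
  have h32 := hc 3 2
  fin_cases i <;> fin_cases j <;> simp [Fin.sum_univ_four, h10, h20, h30, h21, h31, h32] <;> ring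

/-- The scalar curvature of `e^{2w} δ` is `-6 e^{-2w} (Δw + |∇w|²)`. -/
theorem scalarCurvature_eq (H : IsConformallyFlat h w) {x : E4} (hx : x ∈ 𝔹) :
    Coord.scalarCurvature 𝔹 h x = -6 * (Real.exp (-2 * w x) * (lap w x + gradSq w x)) := by
  unfold Coord.scalarCurvature
  simp only [H.ricci_eq _ _ hx, H.inv_eq hx, Matrix.smul_apply, Matrix.one_apply, smul_eq_mul]
  simp [Fin.sum_univ_four]
  unfold lap gradSq
  simp [Fin.sum_univ_four]
  ring

theorem schoutenTrace_eq (H : IsConformallyFlat h w) {x : E4} (hx : x ∈ 𝔹) :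
    Coord.schoutenTrace 𝔹 h x = -(Real.exp (-2 * w x) * (lap w x + gradSq w x)) := by
  unfold Coord.schoutenTrace
  rw [H.scalarCurvature_eq hx]
  norm_num
  ring

theorem schouten_eq (H : IsConformallyFlat h w) (i j : Fin 4) {x : E4} (hx : x ∈ 𝔹) :
    Coord.schouten 𝔹 h i j x = -(𝐃 i (𝐃 j w) x - 𝐃 i w x * 𝐃 j w x)
      - gradSq w x / 2 * (1 : Matrix (Fin 4) (Fin 4) ℝ) i j := by
  have he : Real.exp (-2 * w x) * Real.exp (2 * w x) = 1 := by rw [← Real.exp_add]; simp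
  unfold Coord.schouten
  rw [H.ricci_eq _ _ hx, H.schoutenTrace_eq hx, H.eq x hx, Matrix.smul_apply, smul_eq_mul]
  push_cast
  linear_combination ((lap w x + gradSq w x) * (1 : Matrix (Fin 4) (Fin 4) ℝ) i j / 2) * he

theorem schoutenNormSq_eq (H : IsConformallyFlat h w) {x : E4} (hx : x ∈ 𝔹) :
    Coord.schoutenNormSq 𝔹 h x = Real.exp (-2 * w x) ^ 2 *
      (∑ i, ∑ j, 𝐃 i (𝐃 j w) x ^ 2 + gradSq w x ^ 2
        - 2 * ∑ i, ∑ j, 𝐃 i (𝐃 j w) x * 𝐃 i w x * 𝐃 j w x + lap w x * gradSq w x) := by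
  have hs : Coord.schoutenNormSq 𝔹 h x = Real.exp (-2 * w x) ^ 2 *
      ∑ i, ∑ j, Coord.schouten 𝔹 h i j x ^ 2 := by
    unfold Coord.schoutenNormSq
    rw [H.inv_eq hx]
    simp only [Finset.mul_sum]
    refine Finset.sum_congr rfl fun i _ => Finset.sum_congr rfl fun j _ => ?_
    simp [Matrix.one_apply]
    ring
  rw [hs]
  congr 1
  simp only [H.schouten_eq _ _ hx, Matrix.one_apply]
  unfold lap
  simp [Fin.sum_univ_four]
  have hg : gradSq w x = 𝐃 0 w x * 𝐃 0 w x + 𝐃 1 w x * 𝐃 1 w x + 𝐃 2 w x * 𝐃 2 w x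
    + 𝐃 3 w x * 𝐃 3 w x := by simp [gradSq, Fin.sum_univ_four]
  rw [hg]
  ring

end IsConformallyFlat

theorem partial_gradSq (hw : ContDiffOn ℝ ∞ w 𝔹) (i : Fin 4) {x : E4} (hx : x ∈ 𝔹) :
    𝐃 i (gradSq w) x = 2 * ∑ j, 𝐃 j w x * 𝐃 i (𝐃 j w) x := by
  have hs := fun a => contDiffOn_partial hw a
  unfold gradSq
  rw [partial_sum (fun j => (hs j).mul (hs j)) i hx, Finset.mul_sum]
  refine Finset.sum_congr rfl fun j _ => ?_
  rw [partial_mul (hs j) (hs j) i hx]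
  ring

theorem partial_lap (hw : ContDiffOn ℝ ∞ w 𝔹) (i : Fin 4) {x : E4} (hx : x ∈ 𝔹) :
    𝐃 i (lap w) x = ∑ j, 𝐃 j (𝐃 j (𝐃 i w)) x := by
  have hs := fun a => contDiffOn_partial hw a
  unfold lap
  rw [partial_sum (fun j => contDiffOn_partial (hs j) j) i hx]
  refine Finset.sum_congr rfl fun j _ => ?_
  rw [partial_comm (hs j) i j hx]
  exact partial_congr (fun y hy => partial_comm hw i j hy) j hx

/-- Bochner's formula in Euclidean space. -/
theorem lap_gradSq (hw : ContDiffOn ℝ ∞ w 𝔹) {x : E4} (hx : x ∈ 𝔹) :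
    lap (gradSq w) x = 2 * ∑ i, ∑ j, 𝐃 i (𝐃 j w) x ^ 2
      + 2 * ∑ j, 𝐃 j w x * 𝐃 j (lap w) x := by
  have hs := fun a => contDiffOn_partial hw a
  have hss := fun a b => contDiffOn_partial (hs b) a
  have h1 : ∀ i, 𝐃 i (𝐃 i (gradSq w)) x = 2 * ∑ j, (𝐃 i (𝐃 j w) x ^ 2
      + 𝐃 j w x * 𝐃 i (𝐃 i (𝐃 j w)) x) := fun i => by
    rw [partial_congr (fun y hy => partial_gradSq hw i hy) i hx,
      partial_const_mul (ContDiffOn.sum fun j _ => (hs j).mul (hss i j)) _ i hx,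
      partial_sum (fun j => (hs j).mul (hss i j)) i hx]
    congr 1
    refine Finset.sum_congr rfl fun j _ => ?_
    rw [partial_mul (hs j) (hss i j) i hx]
    ring
  unfold lap
  simp only [h1]
  rw [← Finset.mul_sum, ← mul_add]
  congr 1
  simp only [Finset.sum_add_distrib]
  congr 1
  rw [Finset.sum_comm]
  refine Finset.sum_congr rfl fun j _ => ?_
  rw [← Finset.mul_sum]
  congr 1
  exact (partial_lap hw j hx).symm

theorem lap_exp_mul {S : E4 → ℝ} (hw : ContDiffOn ℝ ∞ w 𝔹) (hS : ContDiffOn ℝ ∞ S 𝔹) {x : E4}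
    (hx : x ∈ 𝔹) : lap (fun y => Real.exp (-2 * w y) * S y) x =
      Real.exp (-2 * w x) * (lap S x - 4 * ∑ i, 𝐃 i w x * 𝐃 i S x - 2 * lap w x * S x
        + 4 * gradSq w x * S x) := by
  have hs := fun a => contDiffOn_partial hw a
  have hE := contDiffOn_exp hw (-2)
  have h1 : ∀ i, ∀ y ∈ 𝔹, 𝐃 i (fun y => Real.exp (-2 * w y) * S y) y =
      Real.exp (-2 * w y) * (𝐃 i S y - 2 * (𝐃 i w y * S y)) := fun i y hy => by
    rw [partial_mul hE hS i hy, partial_exp hw _ i hy]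
    ring
  have h2 : ∀ i, 𝐃 i (𝐃 i (fun y => Real.exp (-2 * w y) * S y)) x =
      Real.exp (-2 * w x) * (𝐃 i (𝐃 i S) x - 4 * (𝐃 i w x * 𝐃 i S x)
        - 2 * S x * 𝐃 i (𝐃 i w) x + 4 * S x * (𝐃 i w x * 𝐃 i w x)) := fun i => by
    have hp := (hs i).mul hS
    rw [partial_congr (fun y hy => h1 i y hy) i hx,
      partial_mul hE ((contDiffOn_partial hS i).sub (contDiffOn_const.mul hp)) i hx,
      partial_exp hw _ i hx, partial_sub (contDiffOn_partial hS i) (contDiffOn_const.mul hp) i hx,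
      partial_const_mul hp _ i hx, partial_mul (hs i) hS i hx]
    ring
  conv_lhs => unfold lap
  simp only [h2]
  rw [← Finset.mul_sum]
  congr 1
  simp only [Finset.sum_add_distrib, Finset.sum_sub_distrib, ← Finset.mul_sum]
  unfold lap gradSq
  ring

namespace IsConformallyFlat

theorem laplaceBeltrami_eq (H : IsConformallyFlat h w) (f : E4 → ℝ) {x : E4} (hx : x ∈ 𝔹) :
    Coord.laplaceBeltrami 𝔹 h f x =
      Real.exp (-2 * w x) * (lap f x + 2 * ∑ i, 𝐃 i w x * 𝐃 i f x) := by
  unfold Coord.laplaceBeltrami lap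
  simp only [H.christoffel_eq _ _ _ hx, H.inv_eq hx, Matrix.smul_apply, Matrix.one_apply,
    smul_eq_mul]
  simp [Fin.sum_univ_four]
  ring

/-- In dimension four the `Q` curvature of `e^{2w} δ` is `e^{-4w} Δ² w`. -/
theorem qCurvature_eq (H : IsConformallyFlat h w) {x : E4} (hx : x ∈ 𝔹) :
    Coord.qCurvature 𝔹 h x = Real.exp (-2 * w x) ^ 2 * lap (lap w) x := by
  have hw := H.smooth
  have hS : ContDiffOn ℝ ∞ (fun y => lap w y + gradSq w y) 𝔹 :=
    (contDiffOn_lap hw).add (contDiffOn_gradSq hw)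
  have hJ : ∀ y ∈ 𝔹, Coord.schoutenTrace 𝔹 h y =
      -(Real.exp (-2 * w y) * (lap w y + gradSq w y)) := fun y hy => H.schoutenTrace_eq hy
  have hd : ∀ i, ∀ y ∈ 𝔹, 𝐃 i (Coord.schoutenTrace 𝔹 h) y =
      -𝐃 i (fun y => Real.exp (-2 * w y) * (lap w y + gradSq w y)) y := fun i y hy => by
    rw [partial_congr hJ i hy, partial_neg i hy]
  have hlap : lap (Coord.schoutenTrace 𝔹 h) x =
      -lap (fun y => Real.exp (-2 * w y) * (lap w y + gradSq w y)) x := by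
    unfold lap
    rw [← Finset.sum_neg_distrib]
    refine Finset.sum_congr rfl fun i _ => ?_
    rw [partial_congr (hd i) i hx, partial_neg i hx]
    rfl
  have hS1 : ∀ i, 𝐃 i (fun y => lap w y + gradSq w y) x =
      𝐃 i (lap w) x + 2 * ∑ j, 𝐃 j w x * 𝐃 i (𝐃 j w) x := fun i => by
    rw [partial_add (contDiffOn_lap hw) (contDiffOn_gradSq hw) i hx, partial_gradSq hw i hx]
  have hS2 : lap (fun y => lap w y + gradSq w y) x = lap (lap w) x +
      (2 * ∑ i, ∑ j, 𝐃 i (𝐃 j w) x ^ 2 + 2 * ∑ j, 𝐃 j w x * 𝐃 j (lap w) x) := by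
    rw [← lap_gradSq hw hx, lap_add (contDiffOn_lap hw) (contDiffOn_gradSq hw) hx]
  have hdE : ∀ i, 𝐃 i (fun y => Real.exp (-2 * w y) * (lap w y + gradSq w y)) x =
      Real.exp (-2 * w x) * (𝐃 i (lap w) x + 2 * (∑ j, 𝐃 j w x * 𝐃 i (𝐃 j w) x)
        - 2 * (lap w x + gradSq w x) * 𝐃 i w x) := fun i => by
    rw [partial_mul (contDiffOn_exp hw (-2)) hS i hx, partial_exp hw _ i hx, hS1 i]
    ring
  have hdot : ∑ i, 𝐃 i w x * (𝐃 i (lap w) x + 2 * ∑ j, 𝐃 j w x * 𝐃 i (𝐃 j w) x) =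
      ∑ i, 𝐃 i w x * 𝐃 i (lap w) x + 2 * ∑ i, ∑ j, 𝐃 i (𝐃 j w) x * 𝐃 i w x * 𝐃 j w x := by
    simp only [mul_add, Finset.sum_add_distrib, Finset.mul_sum]
    congr 1
    refine Finset.sum_congr rfl fun i _ => Finset.sum_congr rfl fun j _ => ?_
    ring
  have hdot2 : ∑ i, 𝐃 i w x * (-(Real.exp (-2 * w x) * (𝐃 i (lap w) x
        + 2 * (∑ j, 𝐃 j w x * 𝐃 i (𝐃 j w) x) - 2 * (lap w x + gradSq w x) * 𝐃 i w x))) =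
      -(Real.exp (-2 * w x) * (∑ i, 𝐃 i w x * 𝐃 i (lap w) x
        + 2 * ∑ i, ∑ j, 𝐃 i (𝐃 j w) x * 𝐃 i w x * 𝐃 j w x
        - 2 * (lap w x + gradSq w x) * gradSq w x)) := by
    rw [← hdot, gradSq, Finset.mul_sum, ← Finset.sum_sub_distrib, Finset.mul_sum,
      ← Finset.sum_neg_distrib]
    refine Finset.sum_congr rfl fun i _ => ?_
    ring
  unfold Coord.qCurvature
  rw [H.laplaceBeltrami_eq _ hx, H.schoutenNormSq_eq hx, H.schoutenTrace_eq hx, hlap,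
    lap_exp_mul hw hS hx, hS2]
  simp only [hd _ x hx, hdE, hS1]
  rw [hdot, hdot2]
  push_cast
  ring

end IsConformallyFlat
end ConformallyFlat

/-! ### A fourth-order radial comparison principle -/

namespace RadialComparison

open Set

/-- The radial system satisfied by the spherical means: `m' = p / t³`, `p' = t³ M`, `M' = q / t³`,
`q' = t³ N` on `(0, 1)`, where `N` dominates the linearization of `Δ² u = 6 (e^{4w} - e^{4w₀})`
at `u = 0` plus a nonnegative remainder `E`, with clamped boundary data at `t = 1` and no flux
at `t = 0`. -/
structure System (m p M q N E : ℝ → ℝ) : Prop where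
  cont_m : ContinuousOn m (Icc 0 1)
  cont_p : ContinuousOn p (Icc 0 1)
  cont_M : ContinuousOn M (Icc 0 1)
  cont_q : ContinuousOn q (Icc 0 1)
  deriv_m : ∀ t ∈ Ioo (0 : ℝ) 1, HasDerivAt m (p t / t ^ 3) t
  deriv_p : ∀ t ∈ Ioo (0 : ℝ) 1, HasDerivAt p (t ^ 3 * M t) t
  deriv_M : ∀ t ∈ Ioo (0 : ℝ) 1, HasDerivAt M (q t / t ^ 3) t
  deriv_q : ∀ t ∈ Ioo (0 : ℝ) 1, HasDerivAt q (t ^ 3 * N t) t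
  ineq : ∀ t ∈ Ioo (0 : ℝ) 1, 96 / (1 + t ^ 2) ^ 4 * (4 * m t + E t) ≤ N t
  nonneg : ∀ t ∈ Ioo (0 : ℝ) 1, 0 ≤ E t
  p_zero : p 0 = 0
  q_zero : q 0 = 0
  m_one : m 1 = 0
  p_one : p 1 = 0
  q_one : q 1 ≤ 0

variable {m p M q N E : ℝ → ℝ}

/-- Going inwards from the boundary, a positive boundary value of `M` would propagate to the
centre, which is incompatible with `p 0 = p 1`. -/
theorem System.M_one_nonpos (H : System m p M q N E) : M 1 ≤ 0 := by
  by_contra! hM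
  have hpos : ∀ t ∈ Icc (0 : ℝ) 1, 0 < M t := by
    by_contra! hex
    obtain ⟨s, hs, hsM⟩ := hex
    have hK : IsCompact (Icc (0 : ℝ) 1 ∩ M ⁻¹' Iic 0) :=
      isCompact_Icc.of_isClosed_subset
        (H.cont_M.preimage_isClosed_of_isClosed isClosed_Icc isClosed_Iic) inter_subset_left
    -- beyond the last point `t₀` with `M ≤ 0` one has `p ≤ 0`, `m ≥ 0` and `q ≤ 0`, so `M` is
    -- antitone on `[t₀, 1]`
    obtain ⟨t₀, ⟨ht₀, ht₀M⟩, hmax⟩ := hK.exists_isGreatest ⟨s, hs, hsM⟩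
    have ht1 : t₀ < 1 := lt_of_le_of_ne ht₀.2 fun h => by
      rw [h] at ht₀M; exact absurd hM (not_lt.2 ht₀M)
    have hMpos : ∀ t ∈ Ioo t₀ 1, 0 < M t := fun t ht => by
      by_contra! h
      exact absurd (hmax ⟨⟨ht₀.1.trans ht.1.le, ht.2.le⟩, h⟩) (not_le.2 ht.1)
    have hsub : Icc t₀ 1 ⊆ Icc 0 1 := Icc_subset_Icc_left ht₀.1
    have hin : ∀ t ∈ Ioo t₀ 1, t ∈ Ioo (0 : ℝ) 1 := fun t ht => ⟨ht₀.1.trans_lt ht.1, ht.2⟩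
    have hp : MonotoneOn p (Icc t₀ 1) := by
      refine monotoneOn_of_hasDerivWithinAt_nonneg (f' := fun t => t ^ 3 * M t)
        (convex_Icc _ _) (H.cont_p.mono hsub) ?_ ?_ <;> rw [interior_Icc] <;> intro t ht
      · exact (H.deriv_p t (hin t ht)).hasDerivWithinAt
      · exact mul_nonneg (pow_nonneg (hin t ht).1.le 3) (hMpos t ht).le
    have hp' : ∀ t ∈ Ioo t₀ 1, p t ≤ 0 := fun t ht =>
      (hp ⟨ht.1.le, ht.2.le⟩ ⟨ht1.le, le_rfl⟩ ht.2.le).trans_eq H.p_one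
    have hm : AntitoneOn m (Icc t₀ 1) := by
      refine antitoneOn_of_hasDerivWithinAt_nonpos (f' := fun t => p t / t ^ 3)
        (convex_Icc _ _) (H.cont_m.mono hsub) ?_ ?_ <;> rw [interior_Icc] <;> intro t ht
      · exact (H.deriv_m t (hin t ht)).hasDerivWithinAt
      · exact div_nonpos_of_nonpos_of_nonneg (hp' t ht) (pow_nonneg (hin t ht).1.le 3)
    have hm' : ∀ t ∈ Ioo t₀ 1, 0 ≤ m t := fun t ht =>
      H.m_one.symm.trans_le (hm ⟨ht.1.le, ht.2.le⟩ ⟨ht1.le, le_rfl⟩ ht.2.le)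
    have hq : MonotoneOn q (Icc t₀ 1) := by
      refine monotoneOn_of_hasDerivWithinAt_nonneg (f' := fun t => t ^ 3 * N t)
        (convex_Icc _ _) (H.cont_q.mono hsub) ?_ ?_ <;> rw [interior_Icc] <;> intro t ht
      · exact (H.deriv_q t (hin t ht)).hasDerivWithinAt
      · have h1 := hm' t ht
        have h2 := H.nonneg t (hin t ht)
        exact mul_nonneg (pow_nonneg (hin t ht).1.le 3)
          ((by positivity : (0 : ℝ) ≤ 96 / (1 + t ^ 2) ^ 4 * (4 * m t + E t)).trans
            (H.ineq t (hin t ht)))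
    have hq' : ∀ t ∈ Ioo t₀ 1, q t ≤ 0 := fun t ht =>
      (hq ⟨ht.1.le, ht.2.le⟩ ⟨ht1.le, le_rfl⟩ ht.2.le).trans H.q_one
    have hMa : AntitoneOn M (Icc t₀ 1) := by
      refine antitoneOn_of_hasDerivWithinAt_nonpos (f' := fun t => q t / t ^ 3)
        (convex_Icc _ _) (H.cont_M.mono hsub) ?_ ?_ <;> rw [interior_Icc] <;> intro t ht
      · exact (H.deriv_M t (hin t ht)).hasDerivWithinAt
      · exact div_nonpos_of_nonpos_of_nonneg (hq' t ht) (pow_nonneg (hin t ht).1.le 3)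
    have := hMa ⟨le_rfl, ht1.le⟩ ⟨ht1.le, le_rfl⟩ ht1.le
    exact absurd (hM.trans_le this) (not_lt.2 ht₀M)
  have hp : StrictMonoOn p (Icc 0 1) := by
    refine strictMonoOn_of_hasDerivWithinAt_pos (f' := fun t => t ^ 3 * M t)
      (convex_Icc _ _) H.cont_p ?_ ?_ <;> rw [interior_Icc] <;> intro t ht
    · exact (H.deriv_p t ht).hasDerivWithinAt
    · exact mul_pos (pow_pos ht.1 3) (hpos t ⟨ht.1.le, ht.2.le⟩)
  have := hp ⟨le_rfl, zero_le_one⟩ ⟨zero_le_one, le_rfl⟩ zero_lt_one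
  rw [H.p_zero, H.p_one] at this
  exact lt_irrefl _ this

/-- Green's formula against the first spherical harmonic `φ = (1 - t²) / (1 + t²)`, which vanishes
on the boundary and solves the linearized equation `Δ² φ = 384 (1 + t²)⁻⁴ φ`, shows that the
remainder vanishes. -/
theorem System.E_eq_zero (H : System m p M q N E) : ∀ t ∈ Ioo (0 : ℝ) 1, E t = 0 := by
  -- `W = φ q - t³ φ' M + (Δφ) p - t³ (Δφ)' m`
  set W : ℝ → ℝ := fun t => (1 - t ^ 2) / (1 + t ^ 2) * q t + 4 * t ^ 4 / (1 + t ^ 2) ^ 2 * M t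
    - 16 / (1 + t ^ 2) ^ 3 * p t - 96 * t ^ 4 / (1 + t ^ 2) ^ 4 * m t with hW
  have hne : ∀ t : ℝ, 1 + t ^ 2 ≠ 0 := fun t => by positivity
  have hcont : ContinuousOn W (Icc 0 1) := by
    have c1 : Continuous fun t : ℝ => (1 - t ^ 2) / (1 + t ^ 2) :=
      (by fun_prop : Continuous fun t : ℝ => 1 - t ^ 2).div (by fun_prop) hne
    have c2 : Continuous fun t : ℝ => 4 * t ^ 4 / (1 + t ^ 2) ^ 2 :=
      (by fun_prop : Continuous fun t : ℝ => 4 * t ^ 4).div (by fun_prop)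
        fun t => pow_ne_zero _ (hne t)
    have c3 : Continuous fun t : ℝ => 16 / (1 + t ^ 2) ^ 3 :=
      continuous_const.div (by fun_prop) fun t => pow_ne_zero _ (hne t)
    have c4 : Continuous fun t : ℝ => 96 * t ^ 4 / (1 + t ^ 2) ^ 4 :=
      (by fun_prop : Continuous fun t : ℝ => 96 * t ^ 4).div (by fun_prop)
        fun t => pow_ne_zero _ (hne t)
    exact (((c1.continuousOn.mul H.cont_q).add (c2.continuousOn.mul H.cont_M)).sub
      (c3.continuousOn.mul H.cont_p)).sub (c4.continuousOn.mul H.cont_m)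
  have hder : ∀ t ∈ Ioo (0 : ℝ) 1, HasDerivAt W ((1 - t ^ 2) / (1 + t ^ 2) * t ^ 3 *
      (N t - 384 / (1 + t ^ 2) ^ 4 * m t)) t := fun t ht => by
    have hs : HasDerivAt (fun t : ℝ => 1 + t ^ 2) (2 * t) t := by
      simpa using (hasDerivAt_pow 2 t).const_add 1
    have hs' : HasDerivAt (fun t : ℝ => 1 - t ^ 2) (-(2 * t)) t := by
      simpa using (hasDerivAt_pow 2 t).const_sub 1
    have h4 : ∀ c : ℝ, HasDerivAt (fun t : ℝ => c * t ^ 4) (c * (4 * t ^ 3)) t := fun c => by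
      simpa using (hasDerivAt_pow 4 t).const_mul c
    have d1 := (hs'.div hs (hne t)).mul (H.deriv_q t ht)
    have d2 := ((h4 4).div (hs.pow 2) (pow_ne_zero _ (hne t))).mul (H.deriv_M t ht)
    have d3 := ((hasDerivAt_const t (16 : ℝ)).div (hs.pow 3) (pow_ne_zero _ (hne t))).mul
      (H.deriv_p t ht)
    have d4 := ((h4 96).div (hs.pow 4) (pow_ne_zero _ (hne t))).mul (H.deriv_m t ht)
    refine (((d1.add d2).sub d3).sub d4).congr_deriv ?_
    have ht0 : t ≠ 0 := ht.1.ne'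
    have hn := hne t
    simp only [Pi.pow_apply, Pi.div_apply]
    push_cast
    field_simp
    ring
  have hder_ge : ∀ t ∈ Ioo (0 : ℝ) 1, (1 - t ^ 2) / (1 + t ^ 2) * t ^ 3 *
      (96 / (1 + t ^ 2) ^ 4 * E t) ≤ (1 - t ^ 2) / (1 + t ^ 2) * t ^ 3 *
      (N t - 384 / (1 + t ^ 2) ^ 4 * m t) := fun t ht => by
    have h0 : 0 ≤ (1 - t ^ 2) / (1 + t ^ 2) * t ^ 3 := by
      have : 0 ≤ 1 - t ^ 2 := by nlinarith [ht.1, ht.2]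
      have := ht.1.le
      positivity
    refine mul_le_mul_of_nonneg_left ?_ h0
    have := H.ineq t ht
    have h2 : 96 / (1 + t ^ 2) ^ 4 * (4 * m t + E t) =
      384 / (1 + t ^ 2) ^ 4 * m t + 96 / (1 + t ^ 2) ^ 4 * E t := by ring
    linarith
  have hweight : ∀ t ∈ Ioo (0 : ℝ) 1,
      0 < (1 - t ^ 2) / (1 + t ^ 2) * t ^ 3 * (96 / (1 + t ^ 2) ^ 4) := fun t ht => by
    have : 0 < 1 - t ^ 2 := by nlinarith [ht.1, ht.2]
    have := ht.1
    positivity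
  have hmono : MonotoneOn W (Icc 0 1) := by
    refine monotoneOn_of_hasDerivWithinAt_nonneg (f' := fun t => (1 - t ^ 2) / (1 + t ^ 2) * t ^ 3 *
      (N t - 384 / (1 + t ^ 2) ^ 4 * m t))
      (convex_Icc _ _) hcont ?_ ?_ <;> rw [interior_Icc] <;> intro t ht
    · exact (hder t ht).hasDerivWithinAt
    · refine le_trans ?_ (hder_ge t ht)
      rw [← mul_assoc]
      exact mul_nonneg (hweight t ht).le (H.nonneg t ht)
  have hW0 : W 0 = 0 := by simp [hW, H.q_zero, H.p_zero]
  have hW1 : W 1 = M 1 := by simp [hW, H.m_one, H.p_one]; norm_num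
  have hconst : ∀ t ∈ Icc (0 : ℝ) 1, W t = 0 := fun t ht =>
    le_antisymm ((hmono ht ⟨zero_le_one, le_rfl⟩ ht.2).trans (hW1.trans_le H.M_one_nonpos))
      (hW0.symm.trans_le (hmono ⟨le_rfl, zero_le_one⟩ ht ht.1))
  intro t ht
  have hd0 : HasDerivAt W 0 t :=
    (hasDerivAt_const t (0 : ℝ)).congr_of_eventuallyEq <| by
      filter_upwards [Ioo_mem_nhds ht.1 ht.2] with s hs using hconst s ⟨hs.1.le, hs.2.le⟩
  have h0 := (hder t ht).unique hd0
  have h1 := hder_ge t ht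
  rw [h0, ← mul_assoc] at h1
  exact le_antisymm (by_contra fun h => absurd h1
    (not_le.2 (mul_pos (hweight t ht) (not_le.1 h)))) (H.nonneg t ht)

end RadialComparison

/-! ### Quaternionic rotations and spherical means -/

namespace SphericalMean

open BallCalculus MeasureTheory Set


/-- Chain rule along a curve in the closed ball, with derivatives taken within the ball. -/
theorem hasDerivAt_comp_curve {f : E4 → ℝ} (hf : ContDiffOn ℝ ∞ f 𝔹) {γ : ℝ → E4} {v : E4} {s : ℝ}
    (hγ : HasDerivAt γ v s) (hmem : ∀ᶠ r in nhds s, γ r ∈ 𝔹) :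
    HasDerivAt (fun r => f (γ r)) (∑ i, v i * 𝐃 i f (γ s)) s := by
  have hs : γ s ∈ 𝔹 := hmem.self_of_nhds
  have h := (diffWithin hf hs).hasFDerivWithinAt.comp_hasDerivWithinAt_of_eq
    (s := {r | γ r ∈ 𝔹}) (x := s) hγ.hasDerivWithinAt (fun r hr => hr) rfl
  rw [fderivWithin_apply_eq] at h
  exact h.hasDerivAt hmem

/-- The Euler field `∑ xᵢ ∂ᵢ f`, that is, `r ∂_r f`. -/
noncomputable def euler (f : E4 → ℝ) (x : E4) : ℝ := ∑ i, x i * 𝐃 i f x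

theorem contDiffOn_euler {f : E4 → ℝ} (hf : ContDiffOn ℝ ∞ f 𝔹) : ContDiffOn ℝ ∞ (euler f) 𝔹 :=
  ContDiffOn.sum fun i _ => (contDiffOn_coord i).mul (contDiffOn_partial hf i)

theorem euler_congr {f g : E4 → ℝ} (h : ∀ x ∈ 𝔹, f x = g x) {x : E4} (hx : x ∈ 𝔹) :
    euler f x = euler g x :=
  Finset.sum_congr rfl fun i _ => by rw [partial_congr h i hx]

theorem euler_sub {f g : E4 → ℝ} (hf : ContDiffOn ℝ ∞ f 𝔹) (hg : ContDiffOn ℝ ∞ g 𝔹) {x : E4}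
    (hx : x ∈ 𝔹) : euler (fun y => f y - g y) x = euler f x - euler g x := by
  unfold euler
  simp only [partial_sub hf hg _ hx, mul_sub, Finset.sum_sub_distrib]

theorem euler_euler {f : E4 → ℝ} (hf : ContDiffOn ℝ ∞ f 𝔹) {x : E4} (hx : x ∈ 𝔹) :
    euler (euler f) x = ∑ i, ∑ j, x i * x j * 𝐃 i (𝐃 j f) x + euler f x := by
  have hs := fun a => contDiffOn_partial hf a
  have h : ∀ i, 𝐃 i (euler f) x = 𝐃 i f x + ∑ j, x j * 𝐃 i (𝐃 j f) x := fun i => by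
    unfold euler
    rw [partial_sum (fun j => (contDiffOn_coord j).mul (hs j)) i hx]
    simp only [partial_mul (contDiffOn_coord _) (hs _) i hx, partial_coord i _ hx,
      Finset.sum_add_distrib]
    simp
  rw [euler]
  simp only [h, mul_add, Finset.sum_add_distrib, Finset.mul_sum, mul_assoc]
  rw [add_comm]
  rfl

/-- `J` is an orthogonal complex structure of `ℝ⁴`: an isometry with `J² = -1`. The orthogonality
`⟪x, J x⟫ = 0`, a consequence, is kept as a field. -/
structure IsComplexStructure (J : E4 →ₗ[ℝ] E4) : Prop where
  orth : ∀ x, ⟪x, J x⟫ = 0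
  norm : ∀ x, ‖J x‖ = ‖x‖
  sq : ∀ x, J (J x) = -x

/-- The rotation `cos s + sin s J` generated by a complex structure. -/
noncomputable def rotation (J : E4 →ₗ[ℝ] E4) (s : ℝ) : E4 →ₗ[ℝ] E4 :=
  Real.cos s • LinearMap.id + Real.sin s • J

theorem rotation_apply (J : E4 →ₗ[ℝ] E4) (s : ℝ) (x : E4) :
    rotation J s x = Real.cos s • x + Real.sin s • J x := rfl

theorem IsComplexStructure.norm_rotation {J : E4 →ₗ[ℝ] E4} (hJ : IsComplexStructure J) (s : ℝ)
    (x : E4) : ‖rotation J s x‖ = ‖x‖ := by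
  have h : ‖rotation J s x‖ ^ 2 = ‖x‖ ^ 2 := by
    rw [rotation_apply, norm_add_sq_real, inner_smul_left, inner_smul_right, hJ.orth, norm_smul,
      norm_smul, hJ.norm, mul_pow, mul_pow, Real.norm_eq_abs, Real.norm_eq_abs, sq_abs, sq_abs]
    have := Real.sin_sq_add_cos_sq s
    simp only [mul_zero, add_zero]
    linear_combination ‖x‖ ^ 2 * this
  exact (sq_eq_sq₀ (norm_nonneg _) (norm_nonneg _)).1 h

/-- The rotation as an isometry of `ℝ⁴`. -/
noncomputable def IsComplexStructure.isometry {J : E4 →ₗ[ℝ] E4} (hJ : IsComplexStructure J)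
    (s : ℝ) : E4 ≃ₗᵢ[ℝ] E4 :=
  LinearIsometry.toLinearIsometryEquiv ⟨rotation J s, hJ.norm_rotation s⟩ rfl

theorem IsComplexStructure.isometry_apply {J : E4 →ₗ[ℝ] E4} (hJ : IsComplexStructure J)
    (s : ℝ) (x : E4) : hJ.isometry s x = rotation J s x := rfl

theorem IsComplexStructure.hasDerivAt_rotation {J : E4 →ₗ[ℝ] E4} (hJ : IsComplexStructure J)
    (x : E4) (s : ℝ) : HasDerivAt (fun r => rotation J r x) (J (rotation J s x)) s := by
  have := ((Real.hasDerivAt_cos s).smul_const x).add ((Real.hasDerivAt_sin s).smul_const (J x))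
  refine this.congr_deriv ?_
  rw [rotation_apply, map_add, map_smul, map_smul, hJ.sq]
  module

/-- The second derivative of `f` along the circle `s ↦ (cos s + sin s J) x`, at `s = 0`, written
out by the chain rule; the first-order term comes from the curvature of the circle. -/
noncomputable def circleDeriv₂ (J : E4 →ₗ[ℝ] E4) (f : E4 → ℝ) (x : E4) : ℝ :=
  ∑ i, (-(x i * 𝐃 i f x) + J x i * ∑ j, J x j * 𝐃 j (𝐃 i f) x)

theorem IsComplexStructure.hasDerivAt_comp_rotation {J : E4 →ₗ[ℝ] E4} (hJ : IsComplexStructure J)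
    {f : E4 → ℝ} (hf : ContDiffOn ℝ ∞ f 𝔹) {x : E4} (hx : x ∈ 𝔹) (s : ℝ) :
    HasDerivAt (fun r => f (rotation J r x))
      (∑ i, J (rotation J s x) i * 𝐃 i f (rotation J s x)) s :=
  hasDerivAt_comp_curve hf (hJ.hasDerivAt_rotation x s) <| Filter.Eventually.of_forall fun r => by
    simpa [hJ.norm_rotation] using hx

theorem IsComplexStructure.hasDerivAt_comp_rotation₂ {J : E4 →ₗ[ℝ] E4}
    (hJ : IsComplexStructure J) {f : E4 → ℝ} (hf : ContDiffOn ℝ ∞ f 𝔹) {x : E4} (hx : x ∈ 𝔹)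
    (s : ℝ) : HasDerivAt (fun r => ∑ i, J (rotation J r x) i * 𝐃 i f (rotation J r x))
      (circleDeriv₂ J f (rotation J s x)) s := by
  refine HasDerivAt.fun_sum fun i _ => ?_
  have h1 : HasDerivAt (fun r => J (rotation J r x)) (-(rotation J s x)) s := by
    have h := (LinearMap.toContinuousLinearMap J).hasFDerivAt.comp_hasDerivAt s
      (hJ.hasDerivAt_rotation x s)
    refine h.congr_deriv ?_
    exact hJ.sq _
  have h2 : HasDerivAt (fun r => J (rotation J r x) i) (-(rotation J s x) i) s :=
    (EuclideanSpace.proj i : E4 →L[ℝ] ℝ).hasFDerivAt.comp_hasDerivAt s h1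
  refine (h2.mul (hJ.hasDerivAt_comp_rotation (contDiffOn_partial hf i) hx s)).congr_deriv ?_
  ring

/-- Left multiplication by the quaternion unit `i`. -/
noncomputable def quatI : E4 →ₗ[ℝ] E4 where
  toFun x := !₂[-x 1, x 0, -x 3, x 2]
  map_add' x y := by ext i; fin_cases i <;> simp <;> ring
  map_smul' c x := by ext i; fin_cases i <;> simp

/-- Left multiplication by the quaternion unit `j`. -/
noncomputable def quatJ : E4 →ₗ[ℝ] E4 where
  toFun x := !₂[-x 2, x 3, x 0, -x 1]
  map_add' x y := by ext i; fin_cases i <;> simp <;> ring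
  map_smul' c x := by ext i; fin_cases i <;> simp

/-- Left multiplication by the quaternion unit `k`. -/
noncomputable def quatK : E4 →ₗ[ℝ] E4 where
  toFun x := !₂[-x 3, -x 2, x 1, x 0]
  map_add' x y := by ext i; fin_cases i <;> simp <;> ring
  map_smul' c x := by ext i; fin_cases i <;> simp

theorem quatI_apply (x : E4) : quatI x = !₂[-x 1, x 0, -x 3, x 2] := rfl
theorem quatJ_apply (x : E4) : quatJ x = !₂[-x 2, x 3, x 0, -x 1] := rfl
theorem quatK_apply (x : E4) : quatK x = !₂[-x 3, -x 2, x 1, x 0] := rfl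

theorem isComplexStructure_quatI : IsComplexStructure quatI where
  orth x := by simp [quatI_apply, PiLp.inner_apply, Fin.sum_univ_four]; ring
  norm x := by simp [quatI_apply, EuclideanSpace.norm_eq, Fin.sum_univ_four]; ring_nf
  sq x := by ext i; fin_cases i <;> simp [quatI_apply]

theorem isComplexStructure_quatJ : IsComplexStructure quatJ where
  orth x := by simp [quatJ_apply, PiLp.inner_apply, Fin.sum_univ_four]; ring
  norm x := by simp [quatJ_apply, EuclideanSpace.norm_eq, Fin.sum_univ_four]; ring_nf
  sq x := by ext i; fin_cases i <;> simp [quatJ_apply]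

theorem isComplexStructure_quatK : IsComplexStructure quatK where
  orth x := by simp [quatK_apply, PiLp.inner_apply, Fin.sum_univ_four]; ring
  norm x := by simp [quatK_apply, EuclideanSpace.norm_eq, Fin.sum_univ_four]; ring_nf
  sq x := by ext i; fin_cases i <;> simp [quatK_apply]

/-- The Laplacian in the orthogonal frame `x, ix, jx, kx`: the second derivatives along the circles
through `x` generated by `i`, `j`, `k` make up `|x|²` times its spherical part. -/
theorem normSq_mul_lap {f : E4 → ℝ} (hf : ContDiffOn ℝ ∞ f 𝔹) {x : E4} (hx : x ∈ 𝔹) :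
    ‖x‖ ^ 2 * lap f x = euler (euler f) x + 2 * euler f x
      + (circleDeriv₂ quatI f x + circleDeriv₂ quatJ f x + circleDeriv₂ quatK f x) := by
  have hc := fun a b => partial_comm hf a b hx
  have h10 := hc 1 0
  have h20 := hc 2 0
  have h30 := hc 3 0
  have h21 := hc 2 1
  have h31 := hc 3 1
  have h32 := hc 3 2
  rw [euler_euler hf hx, EuclideanSpace.real_norm_sq_eq]
  unfold lap circleDeriv₂ euler
  simp [Fin.sum_univ_four, quatI_apply, quatJ_apply, quatK_apply, h10, h20, h30, h21, h31, h32]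
  ring

/-- The spherical mean `∫_{S³} f(tω) dσ(ω)`, not normalized by the area of the sphere. -/
noncomputable def mean (f : E4 → ℝ) (t : ℝ) : ℝ := ∫ x : 𝕊, f (t • x.1) ∂σ

theorem smul_mem_ball {t : ℝ} (ht : t ∈ Icc (0 : ℝ) 1) (x : 𝕊) : t • x.1 ∈ 𝔹 := by
  have hx : ‖x.1‖ = 1 := by simp
  rw [mem_closedBall_zero_iff, norm_smul, hx, mul_one, Real.norm_of_nonneg ht.1]
  exact ht.2

theorem continuousOn_smul {f : E4 → ℝ} (hf : ContinuousOn f 𝔹) :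
    ContinuousOn (Function.uncurry fun (t : ℝ) (x : 𝕊) => f (t • x.1)) (Icc 0 1 ×ˢ univ) := by
  have h : ContinuousOn (fun p : ℝ × 𝕊 => p.1 • p.2.1) (Icc 0 1 ×ˢ univ) := by fun_prop
  exact hf.comp h fun p hp => smul_mem_ball hp.1 p.2

theorem continuous_smul {f : E4 → ℝ} (hf : ContinuousOn f 𝔹) {t : ℝ} (ht : t ∈ Icc (0 : ℝ) 1) :
    Continuous fun x : 𝕊 => f (t • x.1) :=
  hf.comp_continuous (by fun_prop) fun x => smul_mem_ball ht x

theorem integrable_smul {f : E4 → ℝ} (hf : ContinuousOn f 𝔹) {t : ℝ} (ht : t ∈ Icc (0 : ℝ) 1) :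
    Integrable (fun x : 𝕊 => f (t • x.1)) σ :=
  (continuous_smul hf ht).integrable_of_hasCompactSupport (HasCompactSupport.of_compactSpace _)

theorem continuousOn_mean {f : E4 → ℝ} (hf : ContinuousOn f 𝔹) :
    ContinuousOn (mean f) (Icc 0 1) :=
  continuousOn_integral_of_compact_support (k := univ) isCompact_univ (continuousOn_smul hf)
    fun _ _ _ h => absurd (mem_univ _) h

theorem mean_const_mul (f : E4 → ℝ) (c t : ℝ) : mean (fun y => c * f y) t = c * mean f t :=
  integral_const_mul _ _

theorem mean_add {f g : E4 → ℝ} (hf : ContinuousOn f 𝔹) (hg : ContinuousOn g 𝔹) {t : ℝ}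
    (ht : t ∈ Icc (0 : ℝ) 1) : mean (fun y => f y + g y) t = mean f t + mean g t :=
  integral_add (integrable_smul hf ht) (integrable_smul hg ht)

open scoped Pointwise in
/-- The surface measure is invariant under linear isometries. -/
theorem integral_comp_isometry (A : E4 ≃ₗᵢ[ℝ] E4) (f : E4 → ℝ) :
    ∫ x : 𝕊, f (A x.1) ∂σ = ∫ x : 𝕊, f x.1 ∂σ := by
  let e : 𝕊 ≃ₜ 𝕊 :=
    { toFun := fun x => ⟨A x.1, by simp⟩
      invFun := fun x => ⟨A.symm x.1, by simp⟩
      left_inv := fun x => by simp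
      right_inv := fun x => by simp
      continuous_toFun := by fun_prop
      continuous_invFun := by fun_prop }
  have hmp : MeasurePreserving e σ σ := by
    refine ⟨e.continuous.measurable, Measure.ext fun s hs => ?_⟩
    rw [Measure.map_apply e.continuous.measurable hs, Measure.toSphere_apply' _ hs,
      Measure.toSphere_apply' _ (e.continuous.measurable hs)]
    congr 1
    have himg : Ioo (0 : ℝ) 1 • ((↑) '' s : Set E4) = A '' (Ioo (0 : ℝ) 1 • ((↑) '' (e ⁻¹' s))) := by
      ext y
      simp only [mem_image, mem_smul]
      constructor
      · rintro ⟨r, hr, z, ⟨w, hw, rfl⟩, rfl⟩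
        refine ⟨r • (e.symm w).1, ⟨r, hr, _, ⟨e.symm w, by simpa using hw, rfl⟩, rfl⟩, ?_⟩
        rw [map_smul]
        congr 1
        exact congrArg Subtype.val (e.apply_symm_apply w)
      · rintro ⟨_, ⟨r, hr, z, ⟨w, hw, rfl⟩, rfl⟩, rfl⟩
        exact ⟨r, hr, A w.1, ⟨e w, hw, rfl⟩, (map_smul A r w.1).symm⟩
    rw [himg]
    have := (A.measurePreserving).measure_preimage_equiv (f := A.toMeasurableEquiv)
      (A '' (Ioo (0 : ℝ) 1 • ((↑) '' (e ⁻¹' s))))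
    rw [← this]
    congr 1
    exact (preimage_image_eq _ A.injective).symm
  exact hmp.integral_comp e.measurableEmbedding (fun x : 𝕊 => f x.1)

theorem continuousOn_circleDeriv₂ (J : E4 →ₗ[ℝ] E4) {f : E4 → ℝ} (hf : ContDiffOn ℝ ∞ f 𝔹) :
    ContinuousOn (circleDeriv₂ J f) 𝔹 := by
  have hJc : Continuous J := J.continuous_of_finiteDimensional
  have h1 := fun a => (contDiffOn_partial hf a).continuousOn
  have h2 := fun a b => (contDiffOn_partial (contDiffOn_partial hf b) a).continuousOn
  have h3 : ∀ i, Continuous fun x : E4 => J x i := fun i => by fun_prop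
  have h4 : ∀ i, Continuous fun x : E4 => x i := fun i => by fun_prop
  exact continuousOn_finsetSum _ fun i _ => ((h4 i).continuousOn.mul (h1 i)).neg.add
    ((h3 i).continuousOn.mul
      (continuousOn_finsetSum _ fun j _ => (h3 j).continuousOn.mul (h2 j i)))

/-- The second derivative along the orbits of a circle action has mean zero. -/
theorem mean_circleDeriv₂ {J : E4 →ₗ[ℝ] E4} (hJ : IsComplexStructure J) {f : E4 → ℝ}
    (hf : ContDiffOn ℝ ∞ f 𝔹) {t : ℝ} (ht : t ∈ Icc (0 : ℝ) 1) : mean (circleDeriv₂ J f) t = 0 := by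
  have hJc : Continuous J := J.continuous_of_finiteDimensional
  have hcd := continuousOn_circleDeriv₂ J hf
  have hmem : ∀ (s : ℝ) (x : 𝕊), rotation J s (t • x.1) ∈ 𝔹 := fun s x => by
    rw [mem_closedBall_zero_iff, hJ.norm_rotation, ← mem_closedBall_zero_iff]
    exact smul_mem_ball ht x
  have hcont : Continuous fun p : ℝ × 𝕊 => circleDeriv₂ J f (rotation J p.1 (t • p.2.1)) := by
    refine hcd.comp_continuous ?_ fun p => hmem p.1 p.2
    simp only [rotation_apply]
    fun_prop
  -- the integrand is an exact derivative of a function of period `2π`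
  have hinner : ∀ x : 𝕊, ∫ s in (0 : ℝ)..(2 * Real.pi),
      circleDeriv₂ J f (rotation J s (t • x.1)) = 0 := fun x => by
    rw [intervalIntegral.integral_eq_sub_of_hasDerivAt
      (fun s _ => hJ.hasDerivAt_comp_rotation₂ hf (smul_mem_ball ht x) s)
      ((hcont.comp (Continuous.prodMk_left x)).intervalIntegrable _ _)]
    simp [rotation_apply]
  have hrot : ∀ s : ℝ, ∫ x : 𝕊, circleDeriv₂ J f (rotation J s (t • x.1)) ∂σ =
      mean (circleDeriv₂ J f) t := fun s => by
    have := integral_comp_isometry (hJ.isometry s) (fun y => circleDeriv₂ J f (t • y))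
    simp only [hJ.isometry_apply] at this
    rw [mean, ← this]
    simp only [map_smul]
  have hswap : ∫ s in (0 : ℝ)..(2 * Real.pi), (∫ x : 𝕊,
      circleDeriv₂ J f (rotation J s (t • x.1)) ∂σ) = ∫ x : 𝕊, (∫ s in (0 : ℝ)..(2 * Real.pi),
      circleDeriv₂ J f (rotation J s (t • x.1))) ∂σ := by
    simp only [intervalIntegral.integral_of_le Real.two_pi_pos.le]
    refine integral_integral_swap ?_
    obtain ⟨C, hC⟩ := (isCompact_closedBall (0 : E4) 1).exists_bound_of_continuousOn hcd
    exact Integrable.of_bound hcont.aestronglyMeasurable C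
      (Filter.Eventually.of_forall fun p => hC _ (hmem p.1 p.2))
  simp only [hrot, hinner] at hswap
  simpa [Real.pi_ne_zero] using hswap

theorem hasDerivAt_mean {f : E4 → ℝ} (hf : ContDiffOn ℝ ∞ f 𝔹) {t : ℝ} (ht : t ∈ Ioo (0 : ℝ) 1) :
    HasDerivAt (mean f) (mean (euler f) t / t) t := by
  have heu := (contDiffOn_euler hf).continuousOn
  obtain ⟨C, hC⟩ := (isCompact_closedBall (0 : E4) 1).exists_bound_of_continuousOn heu
  have hnhds : Ioo (t / 2) 1 ∈ nhds t := Ioo_mem_nhds (by linarith [ht.1]) ht.2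
  have hin : ∀ s ∈ Ioo (t / 2) 1, s ∈ Ioo (0 : ℝ) 1 := fun s hs => ⟨by linarith [ht.1, hs.1], hs.2⟩
  have hicc : ∀ s ∈ Ioo (0 : ℝ) 1, s ∈ Icc (0 : ℝ) 1 := fun s hs => ⟨hs.1.le, hs.2.le⟩
  have h := (hasDerivAt_integral_of_dominated_loc_of_deriv_le (μ := σ)
    (F := fun (s : ℝ) (x : 𝕊) => f (s • x.1)) (F' := fun s x => euler f (s • x.1) / s)
    (bound := fun _ => C / (t / 2)) hnhds
    (by
      filter_upwards [hnhds] with s hs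
      exact (continuous_smul hf.continuousOn (hicc _ (hin s hs))).aestronglyMeasurable)
    (integrable_smul hf.continuousOn (hicc t ht))
    ((continuous_smul heu (hicc t ht)).div_const t).aestronglyMeasurable
    (Filter.Eventually.of_forall fun x s hs => by
      have h1 := hC _ (smul_mem_ball (hicc _ (hin s hs)) x)
      have h2 : 0 < t / 2 := by linarith [ht.1]
      rw [norm_div, Real.norm_of_nonneg (hin s hs).1.le]
      exact div_le_div₀ ((norm_nonneg _).trans h1) h1 h2 hs.1.le)
    (integrable_const _)
    (Filter.Eventually.of_forall fun x s hs => by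
      have hd : HasDerivAt (fun r : ℝ => r • x.1) x.1 s := by
        simpa using (hasDerivAt_id s).smul_const x.1
      refine (hasDerivAt_comp_curve hf hd ?_).congr_deriv ?_
      · filter_upwards [Ioo_mem_nhds (hin s hs).1 (hin s hs).2] with r hr
          using smul_mem_ball (hicc r hr) x
      · unfold euler
        have hs0 : s ≠ 0 := (hin s hs).1.ne'
        rw [Finset.sum_div]
        refine Finset.sum_congr rfl fun i _ => ?_
        simp only [PiLp.smul_apply, smul_eq_mul]
        field_simp)).2
  refine h.congr_deriv ?_
  rw [integral_div, mean]

/-- The divergence theorem on balls: `t³ ∫_{S³} ∂_r f(tω)` is a primitive of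
`t³ ∫_{S³} Δf(tω)`. -/
theorem hasDerivAt_mean_euler {f : E4 → ℝ} (hf : ContDiffOn ℝ ∞ f 𝔹) {t : ℝ}
    (ht : t ∈ Ioo (0 : ℝ) 1) :
    HasDerivAt (fun s => s ^ 2 * mean (euler f) s) (t ^ 3 * mean (lap f) t) t := by
  have ht' : t ∈ Icc (0 : ℝ) 1 := ⟨ht.1.le, ht.2.le⟩
  have heu := contDiffOn_euler hf
  have h := (hasDerivAt_pow 2 t).mul (hasDerivAt_mean heu ht)
  refine h.congr_deriv ?_
  have key : t ^ 2 * mean (lap f) t = mean (euler (euler f)) t + 2 * mean (euler f) t := by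
    have h1 := (contDiffOn_euler heu).continuousOn
    have h2 : ContinuousOn (fun y => 2 * euler f y) 𝔹 := continuousOn_const.mul heu.continuousOn
    have hc := fun J => continuousOn_circleDeriv₂ J hf
    have e : t ^ 2 * mean (lap f) t = mean (fun y => euler (euler f) y + 2 * euler f y
        + (circleDeriv₂ quatI f y + circleDeriv₂ quatJ f y + circleDeriv₂ quatK f y)) t := by
      rw [← mean_const_mul]
      refine integral_congr_ae (Filter.Eventually.of_forall fun x => ?_)
      simp only
      rw [← normSq_mul_lap hf (smul_mem_ball ht' x), norm_smul, mul_pow]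
      simp
    have h12 : ContinuousOn (fun y => euler (euler f) y + 2 * euler f y) 𝔹 := h1.add h2
    have hc2 : ContinuousOn (fun y => circleDeriv₂ quatI f y + circleDeriv₂ quatJ f y) 𝔹 :=
      (hc _).add (hc _)
    have hc3 : ContinuousOn (fun y => circleDeriv₂ quatI f y + circleDeriv₂ quatJ f y
        + circleDeriv₂ quatK f y) 𝔹 := hc2.add (hc _)
    rw [e, mean_add h12 hc3 ht', mean_add h1 h2 ht', mean_add hc2 (hc _) ht', mean_add (hc _) (hc _) ht', mean_const_mul,
      mean_circleDeriv₂ isComplexStructure_quatI hf ht',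
      mean_circleDeriv₂ isComplexStructure_quatJ hf ht',
      mean_circleDeriv₂ isComplexStructure_quatK hf ht']
    ring
  have ht0 : t ≠ 0 := ht.1.ne'
  have : t ^ 3 * mean (lap f) t = t * (mean (euler (euler f)) t + 2 * mean (euler f) t) := by
    rw [← key]; ring
  rw [this]
  push_cast
  field_simp
  ring

end SphericalMean

/-! ### Uniqueness for the clamped fourth-order inequality -/

namespace SphericalMean

open BallCalculus MeasureTheory Set

theorem mean_mono {f g : E4 → ℝ} (hf : ContinuousOn f 𝔹) (hg : ContinuousOn g 𝔹) {t : ℝ}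
    (ht : t ∈ Icc (0 : ℝ) 1) (h : ∀ x ∈ 𝔹, ‖x‖ = t → f x ≤ g x) : mean f t ≤ mean g t :=
  integral_mono (integrable_smul hf ht) (integrable_smul hg ht) fun x =>
    h _ (smul_mem_ball ht x) (by rw [norm_smul, Real.norm_of_nonneg ht.1]; simp)

theorem eq_zero_of_mean_eq_zero {f : E4 → ℝ} (hf : ContinuousOn f 𝔹) (h0 : ∀ x ∈ 𝔹, 0 ≤ f x)
    {t : ℝ} (ht : t ∈ Icc (0 : ℝ) 1) (h : mean f t = 0) (x : 𝕊) : f (t • x.1) = 0 := by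
  have h1 := (integral_eq_zero_iff_of_nonneg (fun x : 𝕊 => h0 _ (smul_mem_ball ht x))
    (integrable_smul hf ht)).1 h
  exact congrFun (((continuous_smul hf ht).ae_eq_iff_eq σ continuous_const).1 h1) x

theorem mean_eq_zero_of_sphere {f : E4 → ℝ} (h : ∀ x, ‖x‖ = 1 → f x = 0) : mean f 1 = 0 := by
  unfold mean
  simp [h]

/-- Uniqueness for `Δ² u ≥ 6 e^{4w₀} (e^{4u} - 1)` on the unit ball of `ℝ⁴`, where
`e^{w₀} = 2 / (1 + |x|²)`, under clamped boundary conditions and nonpositive total boundary flux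
of `Δ u`. -/
theorem eq_zero_of_bilaplacian_ge {u : E4 → ℝ} (hu : ContDiffOn ℝ ∞ u 𝔹)
    (hlap : ∀ x ∈ 𝔹, 96 / (1 + ‖x‖ ^ 2) ^ 4 * (Real.exp (4 * u x) - 1) ≤ lap (lap u) x)
    (hu0 : ∀ x, ‖x‖ = 1 → u x = 0) (hu1 : ∀ x, ‖x‖ = 1 → euler u x = 0)
    (hflux : ∫ x : 𝕊, euler (lap u) x.1 ∂σ ≤ 0) : ∀ x ∈ 𝔹, u x = 0 := by
  have hl := contDiffOn_lap hu
  have hll := contDiffOn_lap hl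
  have heu := contDiffOn_euler hu
  have hel := contDiffOn_euler hl
  set F : E4 → ℝ := fun x => Real.exp (4 * u x) - 1 - 4 * u x with hF
  have hFc : ContinuousOn F 𝔹 := ((contDiffOn_exp hu 4).continuousOn.sub continuousOn_const).sub
    (continuousOn_const.mul hu.continuousOn)
  have hF0 : ∀ x, 0 ≤ F x := fun x => by
    have := Real.add_one_le_exp (4 * u x)
    simp only [hF]; linarith
  have hIcc : ∀ t ∈ Ioo (0 : ℝ) 1, t ∈ Icc (0 : ℝ) 1 := fun t ht => ⟨ht.1.le, ht.2.le⟩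
  have hpos : ∀ t ∈ Ioo (0 : ℝ) 1, t ≠ 0 := fun t ht => ht.1.ne'
  have hsq : ContinuousOn (fun t : ℝ => t ^ 2) (Icc 0 1) := (continuous_pow 2).continuousOn
  have H : RadialComparison.System (mean u) (fun t => t ^ 2 * mean (euler u) t) (mean (lap u))
      (fun t => t ^ 2 * mean (euler (lap u)) t) (mean (lap (lap u))) (mean F) :=
    { cont_m := continuousOn_mean hu.continuousOn
      cont_p := hsq.mul (continuousOn_mean heu.continuousOn)
      cont_M := continuousOn_mean hl.continuousOn
      cont_q := hsq.mul (continuousOn_mean hel.continuousOn)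
      deriv_m := fun t ht => (hasDerivAt_mean hu ht).congr_deriv (by
        have := hpos t ht; field_simp)
      deriv_p := fun t ht => hasDerivAt_mean_euler hu ht
      deriv_M := fun t ht => (hasDerivAt_mean hl ht).congr_deriv (by
        have := hpos t ht; field_simp)
      deriv_q := fun t ht => hasDerivAt_mean_euler hl ht
      ineq := fun t ht => by
        have h4u : ContinuousOn (fun x => 4 * u x) 𝔹 := continuousOn_const.mul hu.continuousOn
        rw [← mean_const_mul u, ← mean_add h4u hFc (hIcc t ht), ← mean_const_mul]
        have hc : ContinuousOn (fun x => 96 / (1 + t ^ 2) ^ 4 * (4 * u x + F x)) 𝔹 :=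
          continuousOn_const.mul (h4u.add hFc)
        refine mean_mono hc hll.continuousOn (hIcc t ht)
          fun x hx hxt => ?_
        have := hlap x hx
        rw [hxt] at this
        refine le_trans (le_of_eq ?_) this
        simp only [hF]
        ring
      nonneg := fun t _ => integral_nonneg fun x => hF0 _
      p_zero := by simp
      q_zero := by simp
      m_one := mean_eq_zero_of_sphere hu0
      p_one := by simp [mean_eq_zero_of_sphere hu1]
      q_one := by simpa [mean] using hflux }
  have hE := H.E_eq_zero
  have key : ∀ t ∈ Ioo (0 : ℝ) 1, ∀ x : 𝕊, u (t • x.1) = 0 := fun t ht x => by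
    have h := eq_zero_of_mean_eq_zero hFc (fun x _ => hF0 x) (hIcc t ht) (hE t ht) x
    by_contra hne
    have := Real.add_one_lt_exp (x := 4 * u (t • x.1)) (by simpa using hne)
    simp only [hF] at h
    linarith
  have key' : ∀ t ∈ Icc (0 : ℝ) 1, ∀ x : 𝕊, u (t • x.1) = 0 := fun t ht x => by
    have hc : ContinuousOn (fun t : ℝ => u (t • x.1)) (Icc 0 1) :=
      hu.continuousOn.comp (by fun_prop) fun s hs => smul_mem_ball hs x
    have hEq : EqOn (fun t : ℝ => u (t • x.1)) (fun _ => 0) (Ioo 0 1) := fun s hs => key s hs x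
    exact hEq.of_subset_closure hc continuousOn_const Ioo_subset_Icc_self
      (by rw [closure_Ioo zero_ne_one]) ht
  intro x hx
  rw [mem_closedBall_zero_iff] at hx
  by_cases hx0 : x = 0
  · have := key' 0 ⟨le_rfl, zero_le_one⟩ ⟨EuclideanSpace.single 0 1, by simp⟩
    simpa [hx0] using this
  · have hn : ‖x‖ ≠ 0 := norm_ne_zero_iff.2 hx0
    have := key' ‖x‖ ⟨norm_nonneg x, hx⟩ ⟨‖x‖⁻¹ • x, by simp [norm_smul, hn]⟩
    simpa [smul_smul, hn] using this

end SphericalMean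

/-! ### The round metric in stereographic coordinates -/

namespace Background

open BallCalculus SphericalMean

/-- `1 / (1 + |x|²)`, half the factor `e^{w₀}` of the round metric. -/
noncomputable def invRho (x : E4) : ℝ := (1 + ‖x‖ ^ 2)⁻¹

/-- `w₀ = log (2 / (1 + |x|²))`: the round metric is `e^{2 w₀} δ` in stereographic coordinates. -/
noncomputable def roundFactor (x : E4) : ℝ := Real.log (2 * invRho x)

theorem invRho_pos (x : E4) : 0 < invRho x := by unfold invRho; positivity

theorem contDiff_invRho : ContDiff ℝ ∞ invRho :=
  (contDiff_const.add (contDiff_norm_sq ℝ)).inv fun x => by positivity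

theorem contDiffOn_invRho : ContDiffOn ℝ ∞ invRho 𝔹 := contDiff_invRho.contDiffOn

theorem contDiffOn_invRho_pow (k : ℕ) : ContDiffOn ℝ ∞ (fun x => invRho x ^ k) 𝔹 :=
  contDiffOn_invRho.pow k

theorem contDiffOn_roundFactor : ContDiffOn ℝ ∞ roundFactor 𝔹 :=
  (contDiffOn_const.mul contDiffOn_invRho).log fun x _ =>
    (mul_pos two_pos (invRho_pos x)).ne'

theorem exp_roundFactor (x : E4) : Real.exp (roundFactor x) = 2 * invRho x :=
  Real.exp_log (mul_pos two_pos (invRho_pos x))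

theorem partial_invRho (i : Fin 4) {x : E4} (hx : x ∈ 𝔹) :
    𝐃 i invRho x = -2 * (x i * invRho x ^ 2) := by
  have hc : ∀ j : Fin 4, ContDiffOn ℝ ∞ (fun y : E4 => y j * y j) 𝔹 := fun j =>
    (contDiffOn_coord j).mul (contDiffOn_coord j)
  -- differentiate the identity `invRho · (1 + |y|²) = 1`
  have hρ : ∀ y : E4, invRho y * (1 + ∑ j, y j * y j) = 1 := fun y => by
    have h := EuclideanSpace.real_norm_sq_eq y
    simp only [← sq]
    rw [← h, invRho]
    exact inv_mul_cancel₀ (by positivity)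
  have h1 := partial_congr (g := fun _ => 1) (fun y _ => hρ y) i hx
  have hs : ContDiffOn ℝ ∞ (fun y : E4 => 1 + ∑ j, y j * y j) 𝔹 :=
    contDiffOn_const.add (ContDiffOn.sum fun j _ => hc j)
  rw [partial_const, partial_mul contDiffOn_invRho hs i hx,
    partial_add contDiffOn_const (ContDiffOn.sum fun j _ => hc j) i hx, partial_const,
    partial_sum hc i hx] at h1
  simp only [partial_mul (contDiffOn_coord _) (contDiffOn_coord _) i hx, partial_coord i _ hx] at h1
  have h2 : ∑ j, ((if i = j then (1 : ℝ) else 0) * x j + x j * if i = j then 1 else 0) = 2 * x i := by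
    simp [Finset.sum_add_distrib]; ring
  rw [h2] at h1
  linear_combination (-𝐃 i invRho x) * hρ x + invRho x * h1

theorem partial_invRho_pow (k : ℕ) (i : Fin 4) {x : E4} (hx : x ∈ 𝔹) :
    𝐃 i (fun y => invRho y ^ k) x = -2 * k * (x i * invRho x ^ (k + 1)) := by
  induction k with
  | zero => simp [partial_const]
  | succ k ih =>
    simp only [pow_succ _ k]
    rw [partial_mul (contDiffOn_invRho_pow k) contDiffOn_invRho i hx, ih, partial_invRho i hx]
    push_cast
    ring

theorem lap_invRho_pow (k : ℕ) {x : E4} (hx : x ∈ 𝔹) : lap (fun y => invRho y ^ k) x =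
    4 * k * (k - 1) * invRho x ^ (k + 1) - 4 * k * (k + 1) * invRho x ^ (k + 2) := by
  have h : ∀ i, 𝐃 i (𝐃 i fun y => invRho y ^ k) x = -2 * k * (invRho x ^ (k + 1)
      - 2 * (k + 1) * (x i ^ 2 * invRho x ^ (k + 2))) := fun i => by
    have hp := (contDiffOn_coord i).mul (contDiffOn_invRho_pow (k + 1))
    rw [partial_congr (fun y hy => partial_invRho_pow k i hy) i hx,
      partial_const_mul hp _ i hx, partial_mul (contDiffOn_coord i) (contDiffOn_invRho_pow _) i hx,
      partial_coord i i hx, partial_invRho_pow _ i hx, if_pos rfl]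
    push_cast
    ring
  have hn := EuclideanSpace.real_norm_sq_eq x
  have hρ : invRho x * (1 + ‖x‖ ^ 2) = 1 := inv_mul_cancel₀ (by positivity)
  unfold lap
  simp only [h]
  rw [← Finset.mul_sum, Finset.sum_sub_distrib, ← Finset.mul_sum, ← Finset.sum_mul, ← hn]
  simp
  linear_combination (4 * k * (k + 1) * invRho x ^ (k + 1)) * hρ

theorem partial_roundFactor (i : Fin 4) {x : E4} (hx : x ∈ 𝔹) :
    𝐃 i roundFactor x = -2 * (x i * invRho x) := by
  have h1 : 𝐃 i (fun y => Real.exp (1 * roundFactor y)) x = 𝐃 i (fun y => 2 * invRho y) x :=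
    partial_congr (fun y _ => by rw [one_mul, exp_roundFactor]) i hx
  rw [partial_exp contDiffOn_roundFactor _ i hx, partial_const_mul contDiffOn_invRho _ i hx,
    partial_invRho i hx, one_mul, one_mul, exp_roundFactor] at h1
  have := invRho_pos x
  have h2 : (2 * invRho x) * (𝐃 i roundFactor x - -2 * (x i * invRho x)) = 0 := by
    linear_combination h1
  rcases mul_eq_zero.1 h2 with h | h
  · exact absurd h (by positivity)
  · linarith

theorem lap_roundFactor {x : E4} (hx : x ∈ 𝔹) :
    lap roundFactor x = -4 * (invRho x ^ 1 + invRho x ^ 2) := by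
  have h : ∀ i, 𝐃 i (𝐃 i roundFactor) x = -2 * (invRho x - 2 * (x i ^ 2 * invRho x ^ 2)) :=
    fun i => by
    rw [partial_congr (fun y hy => partial_roundFactor i hy) i hx,
      partial_const_mul ((contDiffOn_coord i).mul contDiffOn_invRho) _ i hx,
      partial_mul (contDiffOn_coord i) contDiffOn_invRho i hx, partial_coord i i hx,
      partial_invRho i hx]
    simp
    ring
  have hn := EuclideanSpace.real_norm_sq_eq x
  have hρ : invRho x * (1 + ‖x‖ ^ 2) = 1 := inv_mul_cancel₀ (by positivity)
  unfold lap
  simp only [h]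
  rw [← Finset.mul_sum, Finset.sum_sub_distrib, ← Finset.mul_sum, ← Finset.sum_mul, ← hn]
  simp only [Finset.sum_const, Finset.card_univ, Fintype.card_fin, nsmul_eq_mul]
  push_cast
  linear_combination (4 * invRho x) * hρ

theorem lap_lap_roundFactor {x : E4} (hx : x ∈ 𝔹) :
    lap (lap roundFactor) x = 96 * invRho x ^ 4 := by
  rw [lap_congr (fun y hy => lap_roundFactor hy) hx,
    lap_const_mul ((contDiffOn_invRho_pow 1).add (contDiffOn_invRho_pow 2)) _ hx,
    lap_add (contDiffOn_invRho_pow 1) (contDiffOn_invRho_pow 2) hx, lap_invRho_pow 1 hx,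
    lap_invRho_pow 2 hx]
  push_cast
  ring

theorem invRho_of_norm {x : E4} (hx : ‖x‖ = 1) : invRho x = 1 / 2 := by
  rw [invRho, hx]; norm_num

theorem sum_sq_of_norm {x : E4} (hx : ‖x‖ = 1) : ∑ i, x i * x i = 1 := by
  have h := EuclideanSpace.real_norm_sq_eq x
  rw [hx] at h
  simp only [← sq]
  rw [← h]; norm_num

theorem mem_ball_of_norm {x : E4} (hx : ‖x‖ = 1) : x ∈ 𝔹 := by
  rw [mem_closedBall_zero_iff, hx]

theorem roundFactor_of_norm {x : E4} (hx : ‖x‖ = 1) : roundFactor x = 0 := by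
  rw [roundFactor, invRho_of_norm hx]; norm_num

theorem euler_roundFactor_of_norm {x : E4} (hx : ‖x‖ = 1) : euler roundFactor x = -1 := by
  unfold euler
  simp only [partial_roundFactor _ (mem_ball_of_norm hx), invRho_of_norm hx]
  linear_combination (norm := (simp [Fin.sum_univ_four]; ring)) -sum_sq_of_norm hx

theorem euler_lap_roundFactor_of_norm {x : E4} (hx : ‖x‖ = 1) :
    euler (lap roundFactor) x = 4 := by
  have hb := mem_ball_of_norm hx
  have h : ∀ i, 𝐃 i (lap roundFactor) x = 4 * x i := fun i => by
    rw [partial_congr (fun y hy => lap_roundFactor hy) i hb,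
      partial_const_mul ((contDiffOn_invRho_pow 1).add (contDiffOn_invRho_pow 2)) _ i hb,
      partial_add (contDiffOn_invRho_pow 1) (contDiffOn_invRho_pow 2) i hb,
      partial_invRho_pow 1 i hb, partial_invRho_pow 2 i hb, invRho_of_norm hx]
    push_cast
    ring
  unfold euler
  simp only [h]
  linear_combination (norm := (simp [Fin.sum_univ_four]; ring)) 4 * sum_sq_of_norm hx

end Background

/-! ### Boundary geometry of conformally flat metrics -/

namespace ConformallyFlat

open BallCalculus SphericalMean Background

variable {h : E4 → Matrix (Fin 4) (Fin 4) ℝ} {w : E4 → ℝ}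

namespace IsConformallyFlat

theorem conormalSq_eq (H : IsConformallyFlat h w) {x : E4} (hx : x ∈ 𝔹) :
    Coord.conormalSq h x = Real.exp (-2 * w x) * ∑ i, x i * x i := by
  unfold Coord.conormalSq
  rw [H.inv_eq hx, Finset.mul_sum]
  refine Finset.sum_congr rfl fun i _ => ?_
  simp [Matrix.one_apply]
  ring

theorem outwardNormal_eq (H : IsConformallyFlat h w) (k : Fin 4) {x : E4} (hx : x ∈ 𝔹) :
    Coord.outwardNormal h k x =
      Real.exp (-2 * w x) / √(Real.exp (-2 * w x) * ∑ i, x i * x i) * x k := by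
  unfold Coord.outwardNormal
  rw [H.conormalSq_eq hx, H.inv_eq hx]
  simp [Matrix.one_apply]
  ring

theorem outwardNormal_of_norm (H : IsConformallyFlat h w) (k : Fin 4) {x : E4} (hx : ‖x‖ = 1)
    (hw : w x = 0) : Coord.outwardNormal h k x = x k := by
  rw [H.outwardNormal_eq k (mem_ball_of_norm hx), hw, sum_sq_of_norm hx]
  simp

theorem boundaryDensity_of_norm (H : IsConformallyFlat h w) {x : E4} (hx : ‖x‖ = 1)
    (hw : w x = 0) : Coord.boundaryDensity h x = 1 := by
  have hb := mem_ball_of_norm hx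
  rw [Coord.boundaryDensity, H.conormalSq_eq hb, H.eq x hb, hw, sum_sq_of_norm hx]
  simp

/-- The derivative of the unit normal in a direction tangent to the sphere, where the derivative
of the normalizing factor only contributes a multiple of `x`. -/
theorem exists_deriv_outwardNormal (H : IsConformallyFlat h w) {x : E4} (hx : ‖x‖ = 1)
    (hw : w x = 0) (X : E4) : ∃ c : ℝ, ∀ k, ∑ i, X i * 𝐃 i (Coord.outwardNormal h k) x =
      X k + c * x k := by
  have hb := mem_ball_of_norm hx
  have hs : DifferentiableWithinAt ℝ (fun y : E4 => ∑ i, y i * y i) 𝔹 x :=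
    diffWithin (ContDiffOn.sum fun i _ => (contDiffOn_coord i).mul (contDiffOn_coord i)) hb
  have he := diffWithin (contDiffOn_exp H.smooth (-2)) hb
  have hne : Real.exp (-2 * w x) * ∑ i, x i * x i ≠ 0 := by
    rw [sum_sq_of_norm hx]; simp
  have hp : DifferentiableWithinAt ℝ (fun y : E4 => Real.exp (-2 * w y) * ∑ i, y i * y i) 𝔹 x :=
    he.fun_mul hs
  have hq : DifferentiableWithinAt ℝ
      (fun y : E4 => √(Real.exp (-2 * w y) * ∑ i, y i * y i)) 𝔹 x := hp.sqrt hne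
  have hne' : √(Real.exp (-2 * w x) * ∑ i, x i * x i) ≠ 0 := by
    rw [sum_sq_of_norm hx, mul_one]
    exact (Real.sqrt_pos.2 (Real.exp_pos _)).ne'
  have hA : DifferentiableWithinAt ℝ (fun y : E4 => Real.exp (-2 * w y)
      / √(Real.exp (-2 * w y) * ∑ i, y i * y i)) 𝔹 x := by
    simp only [div_eq_mul_inv]
    exact he.fun_mul (hq.inv hne')
  refine ⟨fderivWithin ℝ (fun y : E4 => Real.exp (-2 * w y)
      / √(Real.exp (-2 * w y) * ∑ i, y i * y i)) 𝔹 x X, fun k => ?_⟩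
  rw [← fderivWithin_apply_eq, fderivWithin_congr (fun y hy => H.outwardNormal_eq k hy)
    (H.outwardNormal_eq k hb), fderivWithin_fun_mul (uniqueDiffOn_ball x hb) hA
      (diffWithin (contDiffOn_coord k) hb)]
  have hc : fderivWithin ℝ (fun y : E4 => y k) 𝔹 x X = X k := by
    rw [fderivWithin_apply_eq]
    simp [partial_coord _ _ hb]
  simp only [add_apply, smul_apply, smul_eq_mul, hc, hw, sum_sq_of_norm hx]
  simp
  ring

/-- Where `w = 0`, the second fundamental form of the unit sphere is `1 + ∂_r w` times the
metric. -/
theorem secondFundamentalForm_eq (H : IsConformallyFlat h w) {x : E4} (hx : ‖x‖ = 1)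
    (hw : w x = 0) {X : E4} (hX : ⟪x, X⟫ = 0) :
    Coord.secondFundamentalForm h x X X = (1 + euler w x) * ‖X‖ ^ 2 := by
  have hb := mem_ball_of_norm hx
  obtain ⟨c, hc⟩ := H.exists_deriv_outwardNormal hx hw X
  have hX' : X 0 * x 0 + X 1 * x 1 + X 2 * x 2 + X 3 * x 3 = 0 := by
    simpa [PiLp.inner_apply, Fin.sum_univ_four] using hX
  unfold Coord.secondFundamentalForm
  simp only [mul_add, Finset.sum_add_distrib, hc]
  simp only [H.christoffel_eq _ _ _ hb, H.outwardNormal_of_norm _ hx hw, H.eq x hb, hw,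
    Matrix.one_apply, EuclideanSpace.real_norm_sq_eq, euler]
  simp [Fin.sum_univ_four]
  linear_combination c * hX'

theorem euler_eq_neg_one (H : IsConformallyFlat h w) {x : E4} (hx : ‖x‖ = 1)
    (hw : w x = 0) (hL : ∀ X : E4, ⟪x, X⟫ = 0 → Coord.secondFundamentalForm h x X X = 0) :
    euler w x = -1 := by
  have h1 := hL (quatI x) (isComplexStructure_quatI.orth x)
  rw [H.secondFundamentalForm_eq hx hw (isComplexStructure_quatI.orth x),
    isComplexStructure_quatI.norm, hx] at h1
  linarith

end IsConformallyFlat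

/-- A function vanishing on the unit sphere is constant along the circles in it. -/
theorem circle_derivs_of_sphere (hw : ContDiffOn ℝ ∞ w 𝔹) (hw0 : ∀ x, ‖x‖ = 1 → w x = 0)
    {J : E4 →ₗ[ℝ] E4} (hJ : IsComplexStructure J) {x : E4} (hx : ‖x‖ = 1) :
    ∑ i, J x i * 𝐃 i w x = 0 ∧ circleDeriv₂ J w x = 0 := by
  have hb := mem_ball_of_norm hx
  have h0 : ∀ s, w (rotation J s x) = 0 := fun s => hw0 _ (by rw [hJ.norm_rotation, hx])
  have h1 : ∀ s, ∑ i, J (rotation J s x) i * 𝐃 i w (rotation J s x) = 0 := fun s =>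
    (hJ.hasDerivAt_comp_rotation hw hb s).unique (by simpa only [h0] using hasDerivAt_const s 0)
  have h2 : ∀ s, circleDeriv₂ J w (rotation J s x) = 0 := fun s =>
    (hJ.hasDerivAt_comp_rotation₂ hw hb s).unique (by simpa only [h1] using hasDerivAt_const s 0)
  have hr : rotation J 0 x = x := by simp [SphericalMean.rotation_apply]
  have e1 := h1 0
  have e2 := h2 0
  rw [hr] at e1 e2
  exact ⟨e1, e2⟩

theorem partial_of_sphere (hw : ContDiffOn ℝ ∞ w 𝔹) (hw0 : ∀ x, ‖x‖ = 1 → w x = 0)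
    (i : Fin 4) {x : E4} (hx : ‖x‖ = 1) : 𝐃 i w x = euler w x * x i := by
  have hI := (circle_derivs_of_sphere hw hw0 isComplexStructure_quatI hx).1
  have hJ := (circle_derivs_of_sphere hw hw0 isComplexStructure_quatJ hx).1
  have hK := (circle_derivs_of_sphere hw hw0 isComplexStructure_quatK hx).1
  have hs := sum_sq_of_norm hx
  unfold euler
  simp [Fin.sum_univ_four, quatI_apply, quatJ_apply, quatK_apply] at hI hJ hK hs ⊢
  -- expansion of the gradient in the orthonormal frame `x, ix, jx, kx`
  fin_cases i <;> simp
  · linear_combination (-x 1) * hI - x 2 * hJ - x 3 * hK - 𝐃 0 w x * hs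
  · linear_combination x 0 * hI + x 3 * hJ - x 2 * hK - 𝐃 1 w x * hs
  · linear_combination (-x 3) * hI + x 0 * hJ + x 1 * hK - 𝐃 2 w x * hs
  · linear_combination x 2 * hI - x 1 * hJ + x 0 * hK - 𝐃 3 w x * hs

theorem lap_of_sphere (hw : ContDiffOn ℝ ∞ w 𝔹) (hw0 : ∀ x, ‖x‖ = 1 → w x = 0)
    {x : E4} (hx : ‖x‖ = 1) : lap w x = euler (euler w) x + 2 * euler w x := by
  have h := normSq_mul_lap hw (mem_ball_of_norm hx)
  rw [(circle_derivs_of_sphere hw hw0 isComplexStructure_quatI hx).2,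
    (circle_derivs_of_sphere hw hw0 isComplexStructure_quatJ hx).2,
    (circle_derivs_of_sphere hw hw0 isComplexStructure_quatK hx).2, hx] at h
  linarith

/-- For `e^{2w} δ` with `w = 0` and `∂_r w = -1` on the unit sphere,
`∂R/∂ν = 24 - 6 ∂_r Δw` there. -/
theorem IsConformallyFlat.normalDeriv_scalarCurvature (H : IsConformallyFlat h w)
    (hw0 : ∀ x, ‖x‖ = 1 → w x = 0) {x : E4} (hx : ‖x‖ = 1) (hw1 : euler w x = -1) :
    Coord.normalDeriv h (Coord.scalarCurvature 𝔹 h) x = 24 - 6 * euler (lap w) x := by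
  have hb := mem_ball_of_norm hx
  have hw := H.smooth
  have hl := contDiffOn_lap hw
  have hg := contDiffOn_gradSq hw
  have hE := contDiffOn_exp hw (-2)
  have hS : ContDiffOn ℝ ∞ (fun y => lap w y + gradSq w y) 𝔹 := hl.add hg
  have hlap := lap_of_sphere hw hw0 hx
  have hp : ∀ i, 𝐃 i w x = -x i := fun i => by
    rw [partial_of_sphere hw hw0 i hx, hw1, neg_one_mul]
  have hgrad : gradSq w x = 1 := by
    rw [← sum_sq_of_norm hx, gradSq]
    simp only [hp, neg_mul_neg]
  have hd : ∀ k, 𝐃 k (Coord.scalarCurvature 𝔹 h) x = -12 * (x k * (lap w x + 1))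
      - 6 * 𝐃 k (lap w) x + 12 * ∑ j, x j * 𝐃 k (𝐃 j w) x := fun k => by
    rw [partial_congr (fun y hy => H.scalarCurvature_eq hy) k hb,
      partial_const_mul (hE.mul hS) _ k hb, partial_mul hE hS k hb, partial_exp hw _ k hb,
      partial_add hl hg k hb, partial_gradSq hw k hb, hp, hgrad, hw0 x hx]
    simp only [hp, neg_mul, Finset.sum_neg_distrib, mul_zero, Real.exp_zero]
    ring
  have hee := euler_euler hw hb
  unfold Coord.normalDeriv
  simp only [H.outwardNormal_of_norm _ hx (hw0 x hx), hd]
  have h1 : ∑ k, x k * (-12 * (x k * (lap w x + 1)) - 6 * 𝐃 k (lap w) x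
      + 12 * ∑ j, x j * 𝐃 k (𝐃 j w) x) = -12 * (lap w x + 1) * ∑ k, x k * x k
      - 6 * euler (lap w) x + 12 * ∑ i, ∑ j, x i * x j * 𝐃 i (𝐃 j w) x := by
    unfold euler
    simp only [Finset.mul_sum, ← Finset.sum_sub_distrib, ← Finset.sum_add_distrib]
    refine Finset.sum_congr rfl fun k _ => ?_
    simp only [mul_add, Finset.mul_sum]
    congr 1
    · ring
    · exact Finset.sum_congr rfl fun j _ => by ring
  rw [h1, sum_sq_of_norm hx]
  linear_combination -12 * hlap - 12 * hee - 36 * hw1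

end ConformallyFlat

/-! ### The hemisphere in stereographic coordinates -/

namespace Hemisphere

open BallCalculus Background ConformallyFlat

/-- Stereographic coordinates cover the hemisphere. -/
theorem exists_point (y : Hemisphere) : ∃ x, ∃ hx : x ∈ 𝔹, point x hx = y := by
  obtain ⟨y, hy, hy5⟩ := y
  have hs : ∑ i : Fin 4, y i.castSucc ^ 2 + y (Fin.last 4) ^ 2 = 1 := by
    have h := EuclideanSpace.real_norm_sq_eq y
    rw [hy, Fin.sum_univ_castSucc] at h
    linarith
  have hpos : 0 < 1 + y (Fin.last 4) := by linarith
  set x : E4 := WithLp.toLp 2 fun i => y i.castSucc / (1 + y (Fin.last 4)) with hxdef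
  have hxi : ∀ i, x i = y i.castSucc / (1 + y (Fin.last 4)) := fun i => rfl
  have hn : ‖x‖ ^ 2 = (1 - y (Fin.last 4)) / (1 + y (Fin.last 4)) := by
    rw [EuclideanSpace.real_norm_sq_eq]
    simp only [hxi, div_pow]
    rw [← Finset.sum_div, div_eq_div_iff (by positivity) hpos.ne']
    linear_combination (1 + y (Fin.last 4)) * hs
  have hx : x ∈ 𝔹 := by
    rw [mem_closedBall_zero_iff]
    have : ‖x‖ ^ 2 ≤ 1 := by
      rw [hn, div_le_one hpos]
      linarith
    nlinarith [norm_nonneg x]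
  refine ⟨x, hx, Subtype.ext ?_⟩
  change stereoInv x = y
  ext i
  refine Fin.lastCases ?_ (fun i => ?_) i
  · rw [stereoInv_last, hn]
    field_simp
    ring
  · rw [stereoInv_castSucc, hn, hxi]
    field_simp
    ring

theorem fderiv_stereoInv_apply (x : E4) (i : Fin 4) (j : Fin 5) (hx : x ∈ 𝔹) :
    fderiv ℝ stereoInv x (EuclideanSpace.single i 1) j = 𝐃 i (fun y => stereoInv y j) x := by
  have hd : HasFDerivAt stereoInv (fderiv ℝ stereoInv x) x :=
    (contDiff_stereoInv.differentiable (by simp) x).hasFDerivAt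
  have h := ((EuclideanSpace.proj j : EuclideanSpace ℝ (Fin 5) →L[ℝ] ℝ).hasFDerivAt.comp x
    hd).hasFDerivWithinAt (s := 𝔹)
  have h' := h.fderivWithin (uniqueDiffOn_ball x hx)
  unfold Coord.partialDeriv
  exact (congrArg (fun L => L (EuclideanSpace.single i 1)) h').symm

/-- The stereographic chart is conformal. -/
theorem inner_fderiv_stereoInv (x : E4) (hx : x ∈ 𝔹) (i j : Fin 4) :
    ⟪fderiv ℝ stereoInv x (EuclideanSpace.single i 1),
      fderiv ℝ stereoInv x (EuclideanSpace.single j 1)⟫ =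
      4 * invRho x ^ 2 * (1 : Matrix (Fin 4) (Fin 4) ℝ) i j := by
  have hn := EuclideanSpace.real_norm_sq_eq x
  have hρ : invRho x * (1 + ‖x‖ ^ 2) = 1 := inv_mul_cancel₀ (by positivity)
  have hc : ∀ a k : Fin 4, fderiv ℝ stereoInv x (EuclideanSpace.single a 1) k.castSucc =
      2 * ((1 : Matrix (Fin 4) (Fin 4) ℝ) a k * invRho x - 2 * (x a * x k * invRho x ^ 2)) :=
    fun a k => by
    rw [fderiv_stereoInv_apply x a _ hx, partial_congr (g := fun y => 2 * (y k * invRho y))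
      (fun y _ => by rw [stereoInv_castSucc, invRho, div_eq_mul_inv, mul_assoc]) a hx,
      partial_const_mul ((contDiffOn_coord k).mul contDiffOn_invRho) _ a hx,
      partial_mul (contDiffOn_coord k) contDiffOn_invRho a hx, partial_coord a k hx,
      partial_invRho a hx, Matrix.one_apply]
    ring
  have hl : ∀ a : Fin 4, fderiv ℝ stereoInv x (EuclideanSpace.single a 1) (Fin.last 4) =
      -4 * (x a * invRho x ^ 2) := fun a => by
    rw [fderiv_stereoInv_apply x a _ hx, partial_congr (g := fun y => 2 * invRho y - 1)
      (fun y _ => by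
        have : (1 + ‖y‖ ^ 2) ≠ 0 := by positivity
        rw [stereoInv_last, invRho]; field_simp; ring) a hx,
      partial_sub (contDiffOn_const.mul contDiffOn_invRho) contDiffOn_const a hx,
      partial_const_mul contDiffOn_invRho _ a hx, partial_invRho a hx, partial_const]
    ring
  rw [PiLp.inner_apply, Fin.sum_univ_castSucc]
  simp only [hc, hl, RCLike.inner_apply, conj_trivial, Matrix.one_apply]
  rw [hn] at hρ
  have e : 4 * invRho x ^ 2 * (if i = j then 1 else 0) = 4 * invRho x ^ 2 * (if i = j then 1 else 0)
      + 16 * x i * x j * invRho x ^ 3 * (invRho x * (1 + ∑ k, x k ^ 2) - 1) := by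
    rw [hρ]; ring
  rw [e]
  simp only [Fin.sum_univ_four]
  fin_cases i <;> fin_cases j <;> simp <;> ring

/-- The equator has a nonzero tangent vector at each point, so that the induced boundary metric
determines the conformal factor there. -/
theorem exists_boundary_tangent (y : Hemisphere) (hy : y.1 (Fin.last 4) = 0) :
    ∃ v : Tangent y, v ≠ 0 ∧ v.1 (Fin.last 4) = 0 := by
  have hs : ∑ i, y.1 i ^ 2 = 1 := by
    rw [← EuclideanSpace.real_norm_sq_eq, y.2.1]; norm_num
  have hy' : y.1 4 = 0 := hy
  refine ⟨⟨!₂[-y.1 1, y.1 0, -y.1 3, y.1 2, 0], ?_⟩, ?_, ?_⟩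
  · rw [Submodule.mem_orthogonal_singleton_iff_inner_right]
    simp [PiLp.inner_apply, Fin.sum_univ_five]
    ring
  · intro h
    have h' := congrArg Subtype.val h
    have e := fun i => congrArg (fun z : EuclideanSpace ℝ (Fin 5) => z i) h'
    have e0 := e 0
    have e1 := e 1
    have e2 := e 2
    have e3 := e 3
    simp at e0 e1 e2 e3
    simp [Fin.sum_univ_five, e0, e1, e2, e3, hy'] at hs
  · rfl

end Hemisphere

namespace HemisphereMetric

open BallCalculus Background ConformallyFlat Hemisphere SphericalMean

theorem components_round (x : E4) (hx : x ∈ 𝔹) :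
    round.components x = (4 * invRho x ^ 2) • (1 : Matrix (Fin 4) (Fin 4) ℝ) := by
  ext i j
  rw [Matrix.smul_apply, smul_eq_mul, ← inner_fderiv_stereoInv x hx i j]
  simp only [components, Hemisphere.components, hx, dite_true, Matrix.of_apply, round,
    innerₗ_apply_apply, Submodule.coe_inner, Hemisphere.coordVector]

theorem isConformallyFlat_round : IsConformallyFlat round.components roundFactor where
  smooth := contDiffOn_roundFactor
  eq x hx := by
    rw [components_round x hx, two_mul, Real.exp_add, exp_roundFactor]
    congr 1
    ring

theorem qCurvature_round {x : E4} (hx : x ∈ 𝔹) : round.qCurvature x = 6 := by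
  have := invRho_pos x
  rw [qCurvature, isConformallyFlat_round.qCurvature_eq hx, lap_lap_roundFactor hx,
    neg_mul, Real.exp_neg, two_mul, Real.exp_add, exp_roundFactor]
  field_simp
  norm_num

variable {g : HemisphereMetric} {f : Hemisphere → ℝ}

/-- A metric conformal to the round one is conformally flat in stereographic coordinates, and the
logarithm of its conformal factor is smooth up to the boundary. -/
theorem exists_isConformallyFlat (hf : ∀ y, 0 < f y)
    (hgf : ∀ y v w, g.form y v w = f y * round.form y v w) :
    ∃ w : E4 → ℝ, IsConformallyFlat g.components w ∧
      ∀ (x : E4) (hx : x ∈ 𝔹), f (point x hx) = Real.exp (2 * (w x - roundFactor x)) := by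
  have hcomp : ∀ (x : E4) (hx : x ∈ 𝔹),
      g.components x = (f (point x hx) * (4 * invRho x ^ 2)) • (1 : Matrix (Fin 4) (Fin 4) ℝ) :=
    fun x hx => by
    rw [mul_smul, ← components_round x hx]
    ext i j
    simp only [components, Hemisphere.components, hx, dite_true, Matrix.of_apply, hgf,
      Matrix.smul_apply, smul_eq_mul]
  have h00 : ∀ (x : E4) (hx : x ∈ 𝔹), g.components x 0 0 = f (point x hx) * (4 * invRho x ^ 2) :=
    fun x hx => by rw [hcomp x hx]; simp
  have hpos : ∀ (x : E4) (hx : x ∈ 𝔹), 0 < f (point x hx) * (4 * invRho x ^ 2) := fun x hx =>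
    mul_pos (hf _) (by have := invRho_pos x; positivity)
  have hexp : ∀ (x : E4) (hx : x ∈ 𝔹), Real.exp (2 * (1 / 2 * Real.log (g.components x 0 0))) =
      f (point x hx) * (4 * invRho x ^ 2) := fun x hx => by
    rw [← mul_assoc, mul_one_div_cancel two_ne_zero, one_mul, h00 x hx, Real.exp_log (hpos x hx)]
  refine ⟨fun x => 1 / 2 * Real.log (g.components x 0 0), ⟨?_, fun x hx => ?_⟩, fun x hx => ?_⟩
  · exact contDiffOn_const.mul ((g.smooth 0 0).log fun x hx => by
      change g.components x 0 0 ≠ 0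
      rw [h00 x hx]; exact (hpos x hx).ne')
  · rw [hexp x hx, hcomp x hx]
  · have := invRho_pos x
    rw [mul_sub, Real.exp_sub, hexp x hx, two_mul, Real.exp_add, exp_roundFactor]
    field_simp
    norm_num

end HemisphereMetric

/-! ### Rigidity of the hemisphere -/

open BallCalculus Background ConformallyFlat Hemisphere SphericalMean HemisphereMetric in
theorem theoremB (g : HemisphereMetric)
    (hconf : g.IsConformalTo HemisphereMetric.round)
    (hQ : ∀ x ∈ Metric.closedBall (0 : EuclideanSpace ℝ (Fin 4)) 1,
      HemisphereMetric.round.qCurvature x ≤ g.qCurvature x)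
    (hbdry : g.SameBoundaryMetric HemisphereMetric.round)
    (hgeod : g.TotallyGeodesicBoundary)
    (hT : 0 ≤ g.integralT) :
    g = HemisphereMetric.round := by
  obtain ⟨f, hf, hgf⟩ := hconf
  obtain ⟨w, H, hfw⟩ := HemisphereMetric.exists_isConformallyFlat hf hgf
  have hw := H.smooth
  have hr := contDiffOn_roundFactor
  have hw0 : ∀ x, ‖x‖ = 1 → w x = 0 := fun x hx => by
    have hb := mem_ball_of_norm hx
    have hlast : (point x hb).1 (Fin.last 4) = 0 := by
      change stereoInv x (Fin.last 4) = 0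
      rw [stereoInv_last, hx]; norm_num
    obtain ⟨v, hv, hv5⟩ := exists_boundary_tangent _ hlast
    have h1 := hbdry _ hlast v v hv5 hv5
    have hf1 : f (point x hb) = 1 :=
      mul_right_cancel₀ (HemisphereMetric.round.pos _ v hv).ne' (by rw [← hgf, h1, one_mul])
    have h2 := hfw x hb
    rw [hf1, roundFactor_of_norm hx, eq_comm, Real.exp_eq_one_iff] at h2
    linarith
  have hw1 : ∀ x, ‖x‖ = 1 → euler w x = -1 := fun x hx =>
    H.euler_eq_neg_one hx (hw0 x hx) fun X hX => hgeod x hx X X hX hX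
  -- the total boundary flux of `Δ (w - w₀)` is `-2 ∫ T`
  have hTint : g.integralT = ∫ x : 𝕊, -(1 / 2) * euler (lap fun y => w y - roundFactor y) x.1 ∂σ := by
    unfold HemisphereMetric.integralT
    refine MeasureTheory.integral_congr_ae (Filter.Eventually.of_forall fun x => ?_)
    have hx : ‖x.1‖ = 1 := by simp
    have hb := mem_ball_of_norm hx
    simp only
    rw [H.boundaryDensity_of_norm hx (hw0 _ hx), mul_one, HemisphereMetric.tCurvature]
    have h1 := H.normalDeriv_scalarCurvature hw0 hx (hw1 _ hx)
    change 1 / 12 * Coord.normalDeriv g.components (Coord.scalarCurvature 𝔹 g.components) x.1 = _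
    have h2 : euler (lap fun y => w y - roundFactor y) x.1 = euler (lap w) x.1 - 4 := by
      rw [← euler_lap_roundFactor_of_norm hx, ← euler_sub (contDiffOn_lap hw) (contDiffOn_lap hr) hb]
      exact euler_congr (fun y hy => lap_sub hw hr hy) hb
    rw [h1, h2]
    ring
  have hu := SphericalMean.eq_zero_of_bilaplacian_ge (hw.sub hr) (fun x hx => ?_)
    (fun x hx => by simp [hw0 x hx, roundFactor_of_norm hx])
    (fun x hx => by
      refine (euler_sub hw hr (mem_ball_of_norm hx)).trans ?_
      rw [hw1 x hx, euler_roundFactor_of_norm hx, sub_self])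
    (by
      rw [MeasureTheory.integral_const_mul] at hTint
      have : 0 ≤ -(1 / 2) * ∫ x : 𝕊, euler (lap fun y => w y - roundFactor y) x.1 ∂σ :=
        hTint ▸ hT
      change ∫ x : 𝕊, euler (lap fun y => w y - roundFactor y) x.1 ∂σ ≤ 0
      linarith)
  · refine HemisphereMetric.ext (funext fun y => ?_)
    obtain ⟨x, hx, rfl⟩ := exists_point y
    refine LinearMap.ext₂ fun v v' => ?_
    have h0 : w x - roundFactor x = 0 := hu x hx
    rw [hgf, hfw x hx, h0]
    simp
  · have hq := hQ x hx
    rw [qCurvature_round hx] at hq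
    have hg : g.qCurvature x = Real.exp (-2 * w x) ^ 2 * lap (lap w) x := H.qCurvature_eq hx
    have h1 : 6 * Real.exp (4 * w x) ≤ lap (lap w) x := by
      have he : Real.exp (-2 * w x) ^ 2 * Real.exp (4 * w x) = 1 := by
        rw [← Real.exp_nat_mul, ← Real.exp_add]
        simp
        ring
      have := mul_le_mul_of_nonneg_left hq (Real.exp_pos (4 * w x)).le
      rw [hg] at this
      linear_combination this + lap (lap w) x * he
    have h2 : lap (lap fun y => w y - roundFactor y) x =
        lap (lap w) x - 96 * invRho x ^ 4 := by
      rw [lap_congr (fun y hy => lap_sub hw hr hy) hx,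
        lap_sub (contDiffOn_lap hw) (contDiffOn_lap hr) hx, lap_lap_roundFactor hx]
    have h3 : Real.exp (4 * w x) =
        Real.exp (4 * (w x - roundFactor x)) * (2 * invRho x) ^ 4 := by
      rw [← exp_roundFactor, ← Real.exp_nat_mul, ← Real.exp_add]
      congr 1
      push_cast
      ring
    change _ ≤ lap (lap fun y => w y - roundFactor y) x
    rw [h2]
    rw [h3] at h1
    have h4 : 96 / (1 + ‖x‖ ^ 2) ^ 4 = 96 * invRho x ^ 4 := by
      rw [invRho, inv_pow, div_eq_mul_inv]
    rw [h4]
    linear_combination h1
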